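/- Let $\delta = e^{2\pi i/6}$, let $\mathbf{Eis} = \mathbb{Z}[\delta] \subset \mathbb{C}$ be the ring of Eisenstein integers, and equip $\mathbb{C}^2$ with the area Hermitian form $$\langle (z_1,z_2),(w_1,w_2)\rangle = \tfrac{i}{4}\,(z_1\overline{w_2} - z_2\overline{w_1}),$$ so that $\langle z,z\rangle$ is the signed area of the triangle with vertices $0, z_1, z_2$. Let $\mathbb{E} = 2\mathbf{Eis}\oplus 2\mathbf{Eis} \subset \mathbb{C}^2$ and $\mathbb{E}^+ = \{z\in\mathbb{E} : \langle z,z\rangle > 0\}$. The group $\langle\delta\rangle\times \mathrm{SL}(2,\mathbb{Z})$ acts on $\mathbb{E}^+$: $\delta$ acts by scalar multiplication and $M\in \mathrm{SL}(2,\mathbb{Z})$ by $z\mapsto Mz$ on column vectors $z=(z_1,z_2)^{T}$. A sphere triangulation is a finite family of oriented unit equilateral triangles whose sides are glued in pairs by orientation-reversing isometries, such that the resulting closed oriented surface is a sphere (different triangles may share several vertices or sides). Two triangulations are equivalent if there is an orientation-preserving isometry between them which sends triangles to triangles, edges to edges and vertices to vertices. A vertex is singular if the number of triangles incident to it (counted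 with multiplicity) is not $6$. Let $HG_{Eis}([3]_4)$ be the set of equivalence classes of sphere triangulations with exactly four singular vertices, each of which is incident to exactly $3$ triangles. For $z=(z_1,z_2)\in\mathbb{E}^+$, take the closed triangle with vertices $0,z_1,z_2$ and glue each of its three sides to itself by the half-turn about its midpoint; the tiling of $\mathbb{C}$ by unit equilateral triangles with vertex set $\mathbf{Eis}$ induces a triangulation of the resulting surface. Theorem. This construction induces a bijection $$\mathbb{E}^+/(\langle\delta\rangle\times \mathrm{SL}(2,\mathbb{Z})) \;\longrightarrow\; HG_{Eis}([3]_4),$$ and for every $z\in\mathbb{E}^+$ the square-norm $\langle z,z\rangle$ is the area of the corresponding triangulation, that is, $\langle z,z\rangle = \frac{\sqrt{3}}{4}\,N$, where $N$ is its number of triangles. -/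

import Mathlib

/-! ## Triangulated oriented surfaces

A triangulation is a finite family of oriented unit equilateral triangles whose sides are glued in
pairs by orientation reversing isometries.  The vertices of every triangle are numbered
counterclockwise by `Fin 3`, and side `i` of a triangle runs from its vertex `i` to its vertex
`i + 1`.  Different triangles may share several vertices or several sides. -/

/-- A closed oriented surface glued from finitely many oriented equilateral triangles.
`glue (t, i) = (t', j)` says that side `i` of `t` is identified with side `j` of `t'`, vertex `i`
of `t` with vertex `j + 1` of `t'`, and vertex `i + 1` of `t` with vertex `j` of `t'`. -/
structure Triangulation where
  Face : Type
  finite_face : Finite Face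
  glue : Face × Fin 3 → Face × Fin 3
  glue_glue : ∀ s, glue (glue s) = s
  glue_ne : ∀ s, glue s ≠ s

namespace Triangulation

/-- The gluing of sides, as a permutation of the sides. -/
def gluePerm (X : Triangulation) : Equiv.Perm (X.Face × Fin 3) where
  toFun := X.glue
  invFun := X.glue
  left_inv := X.glue_glue
  right_inv := X.glue_glue

/-- The counterclockwise rotation around the vertices, as a permutation of the corners
`(t, i)` (the corner of the triangle `t` at its vertex `i`): from `(t, i)` one crosses the side
`i - 1` of `t`, which ends at the vertex `i`. -/
def rotPerm (X : Triangulation) : Equiv.Perm (X.Face × Fin 3) :=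
  ((Equiv.refl X.Face).prodCongr (Equiv.addRight (-1 : Fin 3))).trans X.gluePerm

/-- The vertices of the surface: the cycles of corners under rotation. -/
def Vertex (X : Triangulation) : Type := Quotient (Equiv.Perm.SameCycle.setoid X.rotPerm)

/-- The edges of the surface: the pairs of sides that are glued together. -/
def Edge (X : Triangulation) : Type := Quotient (Equiv.Perm.SameCycle.setoid X.gluePerm)

/-- The vertex at which a corner lies. -/
def vertexOf (X : Triangulation) (c : X.Face × Fin 3) : X.Vertex :=
  Quotient.mk (Equiv.Perm.SameCycle.setoid X.rotPerm) c

/-- The number of triangles incident to a vertex (counted with multiplicity, that is,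
the number of triangle corners at the vertex). -/
noncomputable def degree (X : Triangulation) (v : X.Vertex) : ℕ :=
  Nat.card {c : X.Face × Fin 3 // X.vertexOf c = v}

/-- The surface is connected: any two triangles are joined by a chain of adjacent triangles. -/
def IsConnected (X : Triangulation) : Prop :=
  Nonempty X.Face ∧
    ∀ t t' : X.Face, Relation.ReflTransGen (fun a b => ∃ i j, X.glue (a, i) = (b, j)) t t'

/-- The surface is a sphere: it is connected and its Euler characteristic is `2`. -/
def IsSphere (X : Triangulation) : Prop :=
  X.IsConnected ∧
    (Nat.card X.Vertex : ℤ) - (Nat.card X.Edge : ℤ) + (Nat.card X.Face : ℤ) = 2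

/-- The combinatorial curvature of a vertex, in units of `π / 3`. -/
noncomputable def curvature (X : Triangulation) (v : X.Vertex) : ℤ := 6 - (X.degree v : ℤ)

/-- A vertex is singular if its curvature is not zero. -/
def IsSingular (X : Triangulation) (v : X.Vertex) : Prop := X.curvature v ≠ 0

/-- An orientation preserving isomorphism (an isometry that sends triangles to triangles): a
bijection of corners compatible with the cyclic order of the corners of each triangle and with the
gluing. -/
structure Iso (X Y : Triangulation) where
  toEquiv : X.Face × Fin 3 ≃ Y.Face × Fin 3
  map_next : ∀ t i t' j, toEquiv (t, i) = (t', j) → toEquiv (t, i + 1) = (t', j + 1)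
  map_glue : ∀ s, toEquiv (X.glue s) = Y.glue (toEquiv s)

theorem Iso.symm_next {X Y : Triangulation} (e : Iso X Y) (t : Y.Face) (i : Fin 3) (t' : X.Face)
    (j : Fin 3) (h : e.toEquiv.symm (t, i) = (t', j)) :
    e.toEquiv.symm (t, i + 1) = (t', j + 1) := by
  rw [Equiv.symm_apply_eq] at h ⊢
  exact (e.map_next t' j t i h.symm).symm

def Iso.refl (X : Triangulation) : Iso X X where
  toEquiv := Equiv.refl _
  map_next := by
    intro t i t' j h
    simp only [Equiv.refl_apply, Prod.mk.injEq] at h ⊢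
    exact ⟨h.1, by rw [h.2]⟩
  map_glue := fun _ => rfl

def Iso.symm {X Y : Triangulation} (e : Iso X Y) : Iso Y X where
  toEquiv := e.toEquiv.symm
  map_next := e.symm_next
  map_glue := by
    intro s
    rw [Equiv.symm_apply_eq, e.map_glue, Equiv.apply_symm_apply]

def Iso.trans {X Y Z : Triangulation} (e : Iso X Y) (f : Iso Y Z) : Iso X Z where
  toEquiv := e.toEquiv.trans f.toEquiv
  map_next := by
    intro t i t' j h
    rw [Equiv.trans_apply] at h ⊢
    have h1 := e.map_next t i (e.toEquiv (t, i)).1 (e.toEquiv (t, i)).2 rfl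
    rw [h1]
    exact f.map_next _ _ _ _ h
  map_glue := by
    intro s
    simp only [Equiv.trans_apply, e.map_glue, f.map_glue]

/-- Elementary identification of points of the triangles.  A point of a triangle is given by its
barycentric coordinates; it lies on side `i` if its coordinate at the vertex `i + 2` vanishes. -/
def SideGlued (X : Triangulation) (p q : X.Face × stdSimplex ℝ (Fin 3)) : Prop :=
  ∃ i j : Fin 3, X.glue (p.1, i) = (q.1, j) ∧
    p.2.1 (i + 2) = 0 ∧ q.2.1 (j + 2) = 0 ∧
    q.2.1 j = p.2.1 (i + 1) ∧ q.2.1 (j + 1) = p.2.1 i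

/-- The points of the surface: the disjoint union of the triangles modulo the identification of
their sides. -/
def Realization (X : Triangulation) : Type := Quot X.SideGlued

/-- The point of the surface with barycentric coordinates `w` in the triangle `t`. -/
def point (X : Triangulation) (t : X.Face) (w : stdSimplex ℝ (Fin 3)) : X.Realization :=
  Quot.mk _ (t, w)

end Triangulation

/-- The sphere triangulations with exactly four singular vertices, each incident to three
triangles. -/
def TriangulationsOfType34 : Type 1 :=
  {X : Triangulation // X.IsSphere ∧ Nat.card {v : X.Vertex // X.IsSingular v} = 4 ∧
    ∀ v : X.Vertex, X.IsSingular v → X.degree v = 3}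

instance TriangulationsOfType34.setoid : Setoid TriangulationsOfType34 where
  r X Y := Nonempty (Triangulation.Iso X.1 Y.1)
  iseqv :=
    { refl := fun X => ⟨Triangulation.Iso.refl X.1⟩
      symm := fun ⟨e⟩ => ⟨e.symm⟩
      trans := fun ⟨e⟩ ⟨f⟩ => ⟨e.trans f⟩ }

/-- The set `HG_Eis([3]_4)`: sphere triangulations with exactly four singular vertices, each
incident to three triangles, up to orientation preserving isomorphism. -/
def HGEis34 : Type 1 := Quotient TriangulationsOfType34.setoid

/-! ## Eisenstein lattice triangles -/

/-- `δ = exp (2 π i / 6)`. -/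
noncomputable def delta : ℂ := Complex.exp (2 * (Real.pi : ℂ) * Complex.I / 6)

theorem delta_ne_zero : delta ≠ 0 := Complex.exp_ne_zero _

theorem delta_eq : delta = 1 / 2 + (Real.sqrt 3 : ℂ) / 2 * Complex.I := by
  have h : 2 * (Real.pi : ℂ) * Complex.I / 6 = ((Real.pi / 3 : ℝ) : ℂ) * Complex.I := by
    push_cast; ring
  rw [delta, h, Complex.exp_mul_I, ← Complex.ofReal_cos, ← Complex.ofReal_sin,
    Real.cos_pi_div_three, Real.sin_pi_div_three]
  push_cast; ring

theorem delta_sq : delta * delta = delta - 1 := by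
  have h3 : (Real.sqrt 3 : ℂ) ^ 2 = 3 := by
    rw [← Complex.ofReal_pow, Real.sq_sqrt (by norm_num)]; norm_num
  rw [delta_eq]
  linear_combination (1 / 4 : ℂ) * (Real.sqrt 3 : ℂ) ^ 2 * Complex.I_sq - (1 / 4 : ℂ) * h3

theorem delta_mul_conj : delta * (starRingEnd ℂ) delta = 1 := by
  have h : ‖delta‖ = 1 := by
    have h : 2 * (Real.pi : ℂ) * Complex.I / 6 = ((Real.pi / 3 : ℝ) : ℂ) * Complex.I := by
      push_cast; ring
    rw [delta, h, Complex.norm_exp_ofReal_mul_I]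
  rw [Complex.mul_conj, Complex.normSq_eq_norm_sq, h]; norm_num

/-- `δ` as a unit. -/
noncomputable def deltaUnit : ℂˣ := Units.mk0 delta delta_ne_zero

/-- The ring of Eisenstein integers `ℤ[δ]` in `ℂ`. -/
def Eis : Subring ℂ where
  carrier := {z | ∃ a b : ℤ, z = a + b * delta}
  zero_mem' := ⟨0, 0, by simp⟩
  one_mem' := ⟨1, 0, by simp⟩
  add_mem' := by
    rintro _ _ ⟨a, b, rfl⟩ ⟨c, d, rfl⟩
    exact ⟨a + c, b + d, by push_cast; ring⟩
  neg_mem' := by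
    rintro _ ⟨a, b, rfl⟩
    exact ⟨-a, -b, by push_cast; ring⟩
  mul_mem' := by
    rintro _ _ ⟨a, b, rfl⟩ ⟨c, d, rfl⟩
    refine ⟨a * c - b * d, a * d + b * c + b * d, ?_⟩
    push_cast
    linear_combination (b * d : ℂ) * delta_sq

/-- The area Hermitian form `⟨z, w⟩ = (i / 4) (z₁ w̄₂ - z₂ w̄₁)` on `ℂ²`. -/
noncomputable def areaForm (z w : ℂ × ℂ) : ℂ :=
  Complex.I / 4 * (z.1 * (starRingEnd ℂ) w.2 - z.2 * (starRingEnd ℂ) w.1)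

/-- The square-norm `⟨z, z⟩`, a real number: the signed area of the triangle `0, z₁, z₂`. -/
noncomputable def areaNorm (z : ℂ × ℂ) : ℝ := (areaForm z z).re

theorem coe_areaNorm (z : ℂ × ℂ) : (areaNorm z : ℂ) = areaForm z z := by
  apply Complex.ext
  · simp [areaNorm]
  · simp [areaForm]
    ring

/-- The lattice `E = 2 Eis ⊕ 2 Eis` in `ℂ²`. -/
def latticeE : Set (ℂ × ℂ) :=
  {z | ∃ a ∈ Eis, ∃ b ∈ Eis, z = (2 * a, 2 * b)}

/-- `E⁺`: the elements of `E` of positive square-norm. -/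
def EPlus : Set (ℂ × ℂ) := {z | z ∈ latticeE ∧ 0 < areaNorm z}

/-- The group `⟨δ⟩ × SL(2, ℤ)`. -/
abbrev DeltaSL : Type := Subgroup.zpowers deltaUnit × Matrix.SpecialLinearGroup (Fin 2) ℤ

/-- `(u, M)` acts on the column vector `(z₁, z₂)` by `u • M (z₁, z₂)`. -/
noncomputable def actC (g : DeltaSL) (z : ℂ × ℂ) : ℂ × ℂ :=
  (((g.1 : ℂˣ) : ℂ) * ((g.2 0 0 : ℤ) * z.1 + (g.2 0 1 : ℤ) * z.2),
    ((g.1 : ℂˣ) : ℂ) * ((g.2 1 0 : ℤ) * z.1 + (g.2 1 1 : ℤ) * z.2))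

theorem zpowers_mul_conj (u : Subgroup.zpowers deltaUnit) :
    ((u : ℂˣ) : ℂ) * (starRingEnd ℂ) ((u : ℂˣ) : ℂ) = 1 := by
  obtain ⟨_, k, rfl⟩ := u
  simp only [Units.val_zpow_eq_zpow_val, deltaUnit, Units.val_mk0, map_zpow₀]
  rw [← mul_zpow, delta_mul_conj, one_zpow]

theorem zpowers_mem_Eis (u : Subgroup.zpowers deltaUnit) : ((u : ℂˣ) : ℂ) ∈ Eis := by
  obtain ⟨_, k, rfl⟩ := u
  have hd : delta ∈ Eis := ⟨0, 1, by simp⟩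
  have hi : delta⁻¹ ∈ Eis := by
    refine ⟨1, -1, ?_⟩
    rw [inv_eq_iff_eq_inv, eq_comm, inv_eq_iff_eq_inv, eq_comm]
    refine inv_eq_of_mul_eq_one_right ?_
    push_cast
    linear_combination -delta_sq
  simp only [Units.val_zpow_eq_zpow_val, deltaUnit, Units.val_mk0]
  obtain ⟨n, rfl | rfl⟩ := k.eq_nat_or_neg
  · rw [zpow_natCast]; exact pow_mem hd n
  · rw [zpow_neg, zpow_natCast, ← inv_pow]; exact pow_mem hi n

theorem areaNorm_actC (g : DeltaSL) (z : ℂ × ℂ) : areaNorm (actC g z) = areaNorm z := by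
  have h1 := zpowers_mul_conj g.1
  have h2 : ((g.2 0 0 : ℤ) : ℂ) * (g.2 1 1 : ℤ) - (g.2 0 1 : ℤ) * (g.2 1 0 : ℤ) = 1 := by
    have h := g.2.det_coe
    rw [Matrix.det_fin_two] at h
    exact_mod_cast h
  apply Complex.ofReal_injective
  rw [coe_areaNorm, coe_areaNorm]
  simp only [areaForm, actC, map_mul, map_add, map_intCast]
  set u := ((g.1 : ℂˣ) : ℂ)
  set u' := (starRingEnd ℂ) u
  set D := z.1 * (starRingEnd ℂ) z.2 - z.2 * (starRingEnd ℂ) z.1 with hD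
  linear_combination (Complex.I / 4 * D) * (u * u') * h2 + (Complex.I / 4 * D) * h1

theorem actC_mem_EPlus (g : DeltaSL) {z : ℂ × ℂ} (hz : z ∈ EPlus) : actC g z ∈ EPlus := by
  refine ⟨?_, by rw [areaNorm_actC]; exact hz.2⟩
  obtain ⟨a, ha, b, hb, rfl⟩ := hz.1
  have hu := zpowers_mem_Eis g.1
  refine ⟨_, mul_mem hu (add_mem (mul_mem (intCast_mem Eis (g.2 0 0)) ha)
    (mul_mem (intCast_mem Eis (g.2 0 1)) hb)), _, mul_mem hu (add_mem
    (mul_mem (intCast_mem Eis (g.2 1 0)) ha) (mul_mem (intCast_mem Eis (g.2 1 1)) hb)), ?_⟩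
  simp only [actC]
  ext1 <;> ring

/-- The action of `⟨δ⟩ × SL(2, ℤ)` on `E⁺`. -/
noncomputable instance : MulAction DeltaSL EPlus where
  smul g z := ⟨actC g z.1, actC_mem_EPlus g z.2⟩
  one_smul z := by
    apply Subtype.ext
    change actC 1 z.1 = z.1
    simp [actC]
  mul_smul g h z := by
    apply Subtype.ext
    change actC (g * h) z.1 = actC g (actC h z.1)
    simp only [actC, Prod.fst_mul, Prod.snd_mul, Subgroup.coe_mul, Units.val_mul,
      Matrix.SpecialLinearGroup.coe_mul, Matrix.mul_apply, Fin.sum_univ_two, Int.cast_add,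
      Int.cast_mul]
    ext1 <;> ring

/-- The quotient `E⁺ / (⟨δ⟩ × SL(2, ℤ))`. -/
def EPlusModDeltaSL : Type := MulAction.orbitRel.Quotient DeltaSL EPlus

/-! ## Gluing a lattice triangle -/

/-- The closed triangle with vertices `0, z₁, z₂`. -/
def latticeTriangle (z : ℂ × ℂ) : Set ℂ := convexHull ℝ {0, z.1, z.2}

/-- Identification of boundary points of the triangle `0, z₁, z₂`: each side is folded by the
half-turn about its midpoint. -/
def FoldRel (z : ℂ × ℂ) (x y : latticeTriangle z) : Prop :=
  ((x : ℂ) ∈ segment ℝ 0 z.1 ∧ (y : ℂ) = z.1 - x) ∨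
  ((x : ℂ) ∈ segment ℝ z.1 z.2 ∧ (y : ℂ) = z.1 + z.2 - x) ∨
  ((x : ℂ) ∈ segment ℝ z.2 0 ∧ (y : ℂ) = z.2 - x)

/-- The point with barycentric coordinates `w` in the unit equilateral triangle of the Eisenstein
tiling with the (counterclockwise) vertices `a`, `a + δ ^ k`, `a + δ ^ (k + 1)`. -/
noncomputable def tilePoint (a : ℂ) (k : ℕ) (w : stdSimplex ℝ (Fin 3)) : ℂ :=
  (w.1 0 : ℂ) * a + (w.1 1 : ℂ) * (a + delta ^ k) + (w.1 2 : ℂ) * (a + delta ^ (k + 1))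

/-- Cyclic relabelling of barycentric coordinates. -/
noncomputable def rotateCoords (r : Fin 3) (w : stdSimplex ℝ (Fin 3)) : stdSimplex ℝ (Fin 3) :=
  ⟨fun i => w.1 (i + r), fun i => w.2.1 (i + r), by
    rw [← w.2.2]
    exact Equiv.sum_comp (Equiv.addRight r) w.1⟩

/-- The triangulated surface `X` is obtained from the triangle `0, z₁, z₂` by folding its sides,
with the triangulation induced by the Eisenstein tiling of the plane: there is a map `f` from the
triangle onto `X` which identifies exactly the points that are glued together, and which on the
intersection with any tile of the Eisenstein tiling is an orientation preserving isometry of this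
tile onto a triangle of `X`. -/
def Triangulation.IsGluedFrom (X : Triangulation) (z : ℂ × ℂ) : Prop :=
  ∃ f : latticeTriangle z → X.Realization,
    Function.Surjective f ∧
    (∀ x y, f x = f y ↔ Relation.EqvGen (FoldRel z) x y) ∧
    ∀ a ∈ Eis, ∀ k : ℕ, ∃ (t : X.Face) (r : Fin 3), ∀ (w : stdSimplex ℝ (Fin 3))
      (x : latticeTriangle z), (x : ℂ) = tilePoint a k w → f x = X.point t (rotateCoords r w)

/-! ## Words in the rotation group of the triangular tiling -/

/-! The surfaces in question are the quotients of the tiled plane by a group generated by a lattice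
of translations and a half-turn, so they correspond to sublattices of `2 Eis` of finite index, up to
powers of `δ`.

To see this, let `r` (turn about a vertex) and `n` (next corner of the triangle) act on the corners
of a triangulation. Then `n ^ 3 = 1`, and `r * n` is the gluing, an involution without fixed points.
If all degrees are 3 or 6, then also `r ^ 6 = 1`, so the rotation group of the triangular tiling
acts on the corners. Its translations form a copy of ℤ² that commutes with itself and is turned by
`r` (`transl_add`, `transl_mul_r`). Fix a corner `d` at a singular vertex, so that `r ^ 3` fixes
`d`, and let `L` be the group of translations that fix `d`. It is contained in 2ℤ², since an odd
translation followed by the half-turn would fix a side (`even_of_half_turn`). No rotation of order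
three fixes a corner (`r_sq_mul_transl_ne`). Hence developing from `d` identifies the surface with
the quotient of the plane by `L` and the half-turn (`nonempty_iso`). Conversely, any even lattice of
finite index gives a surface whose singular vertices are the four two-torsion points of the torus
(`latticeTriangulation_type34`). Changing `d` changes `L` by a power of `δ`
(`latticeType34_equiv_iff`).

On the other side, `z` in `EPlus` is a positively oriented basis of such a lattice, and `SL(2, ℤ)`
permutes the positively oriented bases of a given lattice simply transitively. Thus orbits are also
lattices up to powers of `δ` (`orbit_iff_periodLattice`, `exists_periodLattice_eq`). The faces are
the cosets of the lattice, so their number is its index, a determinant that is proportional to the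
area (`areaNorm_eq_card`).

Finally, the triangle `0, z₁, z₂` is a fundamental domain for the group of translations and
half-turns, which identifies its boundary points exactly by folding the sides
(`halfTurnSetoid_iff_foldRel`). So the folded triangle is the surface built from the lattice
(`latticeTriangulation_isGluedFrom`). -/

/-- Multiplication by `δ` in the coordinates `(x, y) ↦ x + y δ`. -/
def mulDelta (b : ℤ × ℤ) : ℤ × ℤ := (-b.2, b.1 + b.2)

theorem mulDelta_mulDelta (b : ℤ × ℤ) : mulDelta (mulDelta b) = (-b.1 - b.2, b.1) := by
  ext
  · simp [mulDelta]; ring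
  · simp [mulDelta]

theorem mulDelta_iterate_three (b : ℤ × ℤ) : mulDelta (mulDelta (mulDelta b)) = -b := by
  ext <;> simp [mulDelta]

/-- Two elements `r` (rotation about a vertex) and `n` (rotation about the centre of a triangle)
of a group that satisfy the relations of the rotation group of the triangular tiling. -/
structure TilingRelations {G : Type*} [Group G] (r n : G) : Prop where
  r_pow : r ^ 6 = 1
  n_pow : n ^ 3 = 1
  mul_sq : (r * n) ^ 2 = 1

/-- The element that acts as the translation by `x + y δ`. -/
def transl {G : Type*} [Group G] (r n : G) (b : ℤ × ℤ) : G :=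
  ((r ^ 2)⁻¹ * n) ^ b.1 * (r⁻¹ * ((r ^ 2)⁻¹ * n) * r) ^ b.2

theorem transl_zero {G : Type*} [Group G] (r n : G) : transl r n 0 = 1 := by simp [transl]

theorem transl_one {G : Type*} [Group G] (r n : G) : transl r n (1, 0) = (r ^ 2)⁻¹ * n := by
  simp [transl]

theorem eq_sq_mul_transl {G : Type*} [Group G] (r n : G) : n = r ^ 2 * transl r n (1, 0) := by
  rw [transl_one, mul_inv_cancel_left]

namespace TilingRelations

variable {G : Type*} [Group G] {r n : G}

/-- This is the relation `(r * n) ^ 2 = 1` rewritten: the half-turn `r ^ 3` inverts the unit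
translation. -/
theorem conj_cube (h : TilingRelations r n) :
    r ^ 3 * ((r ^ 2)⁻¹ * n) * r ^ 3 = ((r ^ 2)⁻¹ * n)⁻¹ := by
  apply eq_inv_of_mul_eq_one_left
  have := h.mul_sq
  rw [sq (r * n)] at this
  rw [← this]
  group

theorem r_cube_inv (h : TilingRelations r n) : (r ^ 3)⁻¹ = r ^ 3 := by
  apply inv_eq_of_mul_eq_one_right
  rw [← pow_add, h.r_pow]

/-- Conjugation by `r` turns a translation by `δ`, so this is `δ² + 1 = δ` for translations. It is
where `n ^ 3 = 1` enters. -/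
theorem conj_conj_mul (h : TilingRelations r n) :
    r⁻¹ * (r⁻¹ * ((r ^ 2)⁻¹ * n) * r) * r * ((r ^ 2)⁻¹ * n) = r⁻¹ * ((r ^ 2)⁻¹ * n) * r := by
  have h2 : n * n * n = 1 := by rw [← h.n_pow, pow_succ, sq]
  calc r⁻¹ * (r⁻¹ * ((r ^ 2)⁻¹ * n) * r) * r * ((r ^ 2)⁻¹ * n)
      = r ^ (-4 : ℤ) * (n * n * n) * ((r ^ 2)⁻¹ * n)⁻¹ * (r ^ 2)⁻¹ := by group
    _ = r⁻¹ * ((r ^ 2)⁻¹ * n) * r := by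
        rw [← h.conj_cube, h2]; group

theorem conj_conj_conj (h : TilingRelations r n) :
    r⁻¹ * (r⁻¹ * (r⁻¹ * ((r ^ 2)⁻¹ * n) * r) * r) * r = ((r ^ 2)⁻¹ * n)⁻¹ := by
  calc r⁻¹ * (r⁻¹ * (r⁻¹ * ((r ^ 2)⁻¹ * n) * r) * r) * r
      = (r ^ 3)⁻¹ * ((r ^ 2)⁻¹ * n) * r ^ 3 := by
        simp only [pow_succ, pow_zero, one_mul, mul_inv_rev, mul_assoc]
    _ = ((r ^ 2)⁻¹ * n)⁻¹ := by rw [h.r_cube_inv, h.conj_cube]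

/-- Write `A`, `B`, `C` for the translations along `1`, `δ`, `δ²`. The relation `C * A = B` gives `C
= B * A⁻¹`, while its conjugate by `r` gives `C = A⁻¹ * B`. Comparing the two shows that `A` and `B`
commute. -/
theorem commute_gens (h : TilingRelations r n) :
    Commute ((r ^ 2)⁻¹ * n) (r⁻¹ * ((r ^ 2)⁻¹ * n) * r) := by
  have h1 := h.conj_conj_mul
  have h3 := h.conj_conj_conj
  set A := (r ^ 2)⁻¹ * n
  set B := r⁻¹ * A * r
  set C := r⁻¹ * B * r
  have h4 : A⁻¹ * B = C := by
    rw [← h3]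
    calc r⁻¹ * C * r * B = r⁻¹ * (C * A) * r := by simp only [B]; group
      _ = C := by rw [h1]
  have h5 : C = B * A⁻¹ := by rw [← h1]; group
  rw [h5] at h4
  change A * B = B * A
  calc A * B = A * (B * A⁻¹) * A := by group
    _ = B * A := by rw [← h4]; group

theorem transl_add (h : TilingRelations r n) (a b : ℤ × ℤ) :
    transl r n (a + b) = transl r n a * transl r n b := by
  have hc := h.commute_gens
  simp only [transl, Prod.fst_add, Prod.snd_add, zpow_add]
  generalize r⁻¹ * ((r ^ 2)⁻¹ * n) * r = B at *
  rw [mul_assoc, mul_assoc, (hc.zpow_zpow b.1 a.2).left_comm]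

theorem transl_neg (h : TilingRelations r n) (a : ℤ × ℤ) :
    transl r n (-a) = (transl r n a)⁻¹ := by
  apply eq_inv_of_mul_eq_one_left
  rw [← h.transl_add, neg_add_cancel, transl_zero]

theorem transl_comm (h : TilingRelations r n) (a b : ℤ × ℤ) :
    transl r n a * transl r n b = transl r n b * transl r n a := by
  rw [← h.transl_add, add_comm, h.transl_add]

/-- A translation read after a turn is the turned translation read before it: conjugation by `r`
sends `A` to `B` and `B` to `A⁻¹ * B`, which in coordinates is multiplication by `δ`. -/
theorem transl_mul_r (h : TilingRelations r n) (b : ℤ × ℤ) :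
    transl r n b * r = r * transl r n (mulDelta b) := by
  have hc := h.commute_gens
  have h1 := h.conj_conj_mul
  simp only [transl, mulDelta]
  set A := (r ^ 2)⁻¹ * n
  set B := r⁻¹ * A * r with hB
  set C := r⁻¹ * B * r with hC
  have h5 : C = A⁻¹ * B := by rw [hc.inv_left.eq, ← h1]; group
  have e1 : A ^ b.1 * r = r * B ^ b.1 := by
    have : B = r⁻¹ * A * r⁻¹⁻¹ := by rw [inv_inv]
    rw [this, conj_zpow]; group
  have e2 : B ^ b.2 * r = r * C ^ b.2 := by
    have : C = r⁻¹ * B * r⁻¹⁻¹ := by rw [inv_inv]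
    rw [this, conj_zpow]; group
  rw [mul_assoc, e2, ← mul_assoc, e1, mul_assoc, h5, hc.inv_left.mul_zpow, inv_zpow', zpow_add,
    (hc.zpow_zpow _ _).left_comm]

theorem transl_mul_r_pow (h : TilingRelations r n) (k : ℕ) (b : ℤ × ℤ) :
    transl r n b * r ^ k = r ^ k * transl r n (mulDelta^[k] b) := by
  induction k generalizing b with
  | zero => simp
  | succ k ih =>
    rw [pow_succ', ← mul_assoc, h.transl_mul_r, mul_assoc, ih, Function.iterate_succ_apply,
      mul_assoc]

theorem transl_mul_r_cube (h : TilingRelations r n) (b : ℤ × ℤ) :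
    transl r n b * r ^ 3 = r ^ 3 * transl r n (-b) := by
  rw [h.transl_mul_r_pow]
  simp [mulDelta_iterate_three]

theorem transl_delta (h : TilingRelations r n) :
    transl r n (0, 1) = r⁻¹ * transl r n (1, 0) * r := by
  rw [mul_assoc, h.transl_mul_r, inv_mul_cancel_left]
  simp [mulDelta]

end TilingRelations

theorem map_transl {G H : Type*} [Group G] [Group H] (f : G →* H) (r n : G) (b : ℤ × ℤ) :
    f (transl r n b) = transl (f r) (f n) b := by
  simp [transl]

/-- The translations that fix a point. -/
def TilingRelations.stab {D : Type*} {r n : Equiv.Perm D} (h : TilingRelations r n) (d : D) :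
    AddSubgroup (ℤ × ℤ) where
  carrier := {b | transl r n b d = d}
  zero_mem' := by simp [transl_zero]
  add_mem' := by
    intro a b ha hb
    simp only [Set.mem_ofPred_eq] at ha hb ⊢
    rw [h.transl_add, Equiv.Perm.mul_apply, hb, ha]
  neg_mem' := by
    intro a ha
    simp only [Set.mem_ofPred_eq] at ha ⊢
    rw [h.transl_neg, Equiv.Perm.inv_eq_iff_eq, ha]

theorem TilingRelations.mem_stab {D : Type*} {r n : Equiv.Perm D} (h : TilingRelations r n) {d : D}
    {b : ℤ × ℤ} : b ∈ h.stab d ↔ transl r n b d = d := Iff.rfl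

/-- Translations commute, so translating the base point does not change its stabilizer, and `r ^ k`
only turns it. -/
theorem TilingRelations.mem_stab_r_pow_transl {D : Type*} {r n : Equiv.Perm D}
    (h : TilingRelations r n) {d : D} (k : ℕ) (a b : ℤ × ℤ) :
    b ∈ h.stab ((r ^ k) (transl r n a d)) ↔ mulDelta^[k] b ∈ h.stab d := by
  rw [h.mem_stab, h.mem_stab, ← Equiv.Perm.mul_apply, h.transl_mul_r_pow, Equiv.Perm.mul_apply,
    (r ^ k).injective.eq_iff, ← Equiv.Perm.mul_apply, h.transl_comm, Equiv.Perm.mul_apply,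
    (transl r n a).injective.eq_iff]

theorem TilingRelations.stab_finiteIndex {D : Type*} [Finite D] {r n : Equiv.Perm D}
    (h : TilingRelations r n) (d : D) : Finite ((ℤ × ℤ) ⧸ h.stab d) := by
  let f : (ℤ × ℤ) ⧸ h.stab d → D := Quotient.lift (fun b => transl r n b d) (by
    intro a b hab
    have h1 : -a + b ∈ h.stab d := QuotientAddGroup.leftRel_apply.mp hab
    rw [h.mem_stab, h.transl_add, h.transl_neg, Equiv.Perm.mul_apply,
      Equiv.Perm.inv_eq_iff_eq] at h1
    exact h1.symm)
  refine Finite.of_injective f ?_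
  intro x y
  induction x using QuotientAddGroup.induction_on with | H a => ?_
  induction y using QuotientAddGroup.induction_on with | H b => ?_
  intro hab
  refine QuotientAddGroup.eq.mpr ?_
  rw [h.mem_stab, h.transl_add, h.transl_neg, Equiv.Perm.mul_apply, Equiv.Perm.inv_eq_iff_eq]
  exact hab.symm

/-! ### The corner permutations of a triangulation -/

namespace Triangulation

/-- The corners of the same triangle, in their cyclic order. -/
def nextPerm (X : Triangulation) : Equiv.Perm (X.Face × Fin 3) :=
  (Equiv.refl X.Face).prodCongr (Equiv.addRight (1 : Fin 3))

variable {X Y : Triangulation}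

instance : Finite (X.Face × Fin 3) := by
  have := X.finite_face
  infer_instance

theorem nextPerm_apply (c : X.Face × Fin 3) : X.nextPerm c = (c.1, c.2 + 1) := rfl

theorem gluePerm_apply (c : X.Face × Fin 3) : X.gluePerm c = X.glue c := rfl

theorem rotPerm_apply (c : X.Face × Fin 3) : X.rotPerm c = X.glue (c.1, c.2 - 1) := by
  rw [sub_eq_add_neg]; rfl

theorem nextPerm_pow (k : ℕ) (c : X.Face × Fin 3) :
    (X.nextPerm ^ k) c = (c.1, c.2 + k • (1 : Fin 3)) := by
  induction k with
  | zero => simp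
  | succ k ih => rw [pow_succ', Equiv.Perm.mul_apply, ih, nextPerm_apply, succ_nsmul, add_assoc]

theorem nextPerm_pow_three : X.nextPerm ^ 3 = 1 := by
  ext1 c
  rw [nextPerm_pow, show 3 • (1 : Fin 3) = 0 from rfl, add_zero]; rfl

theorem rotPerm_mul_nextPerm : X.rotPerm * X.nextPerm = X.gluePerm := by
  ext1 c
  rw [Equiv.Perm.mul_apply, rotPerm_apply, nextPerm_apply, gluePerm_apply, add_sub_cancel_right]

theorem gluePerm_sq : X.gluePerm ^ 2 = 1 := by
  ext1 c
  exact X.glue_glue c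

theorem tilingRelations (h : X.rotPerm ^ 6 = 1) : TilingRelations X.rotPerm X.nextPerm :=
  ⟨h, nextPerm_pow_three, by rw [rotPerm_mul_nextPerm, gluePerm_sq]⟩

theorem nextPerm_ne (c : X.Face × Fin 3) : X.nextPerm c ≠ c := by
  intro h
  have := congrArg Prod.snd h
  simp [nextPerm_apply] at this

theorem vertexOf_eq_iff {c c' : X.Face × Fin 3} :
    X.vertexOf c = X.vertexOf c' ↔ X.rotPerm.SameCycle c c' := Quotient.eq

theorem degree_eq_minimalPeriod (c : X.Face × Fin 3) :
    X.degree (X.vertexOf c) = Function.minimalPeriod X.rotPerm c := by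
  have : Fintype (MulAction.orbit (Subgroup.zpowers X.rotPerm) c) := Fintype.ofFinite _
  have h := MulAction.minimalPeriod_eq_card (a := X.rotPerm) (b := c)
  refine Eq.trans ?_ h.symm
  rw [← Nat.card_eq_fintype_card, degree]
  refine Nat.card_congr (Equiv.subtypeEquivRight ?_)
  intro c'
  rw [eq_comm, vertexOf_eq_iff]
  constructor
  · rintro ⟨k, rfl⟩
    exact ⟨⟨X.rotPerm ^ k, k, rfl⟩, rfl⟩
  · rintro ⟨⟨_, k, rfl⟩, rfl⟩
    exact ⟨k, rfl⟩

theorem rotPerm_pow_eq_iff {c : X.Face × Fin 3} {k : ℕ} :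
    (X.rotPerm ^ k) c = c ↔ X.degree (X.vertexOf c) ∣ k := by
  rw [degree_eq_minimalPeriod, ← Function.isPeriodicPt_iff_minimalPeriod_dvd,
    Function.IsPeriodicPt, Function.IsFixedPt, Equiv.Perm.iterate_eq_pow]

/-- Connectedness in the form needed for the group action: `nextPerm` and the gluing act
transitively on the corners. -/
theorem IsConnected.dart_induction (hX : X.IsConnected) {P : X.Face × Fin 3 → Prop}
    (d : X.Face × Fin 3) (h0 : P d) (hn : ∀ c, P c → P (X.nextPerm c))
    (hg : ∀ c, P c → P (X.glue c)) (c : X.Face × Fin 3) : P c := by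
  have hnext : ∀ t i j, P (t, i) → P (t, j) := by
    intro t i j h
    have h1 := hn _ h
    have h2 := hn _ h1
    rw [nextPerm_apply, nextPerm_apply] at h2
    rw [nextPerm_apply] at h1
    have hj : ∀ i j : Fin 3, j = i ∨ j = i + 1 ∨ j = i + 1 + 1 := by decide
    rcases hj i j with rfl | rfl | rfl
    exacts [h, h1, h2]
  have key : ∀ t, Relation.ReflTransGen (fun a b => ∃ i j, X.glue (a, i) = (b, j)) d.1 t →
      ∀ i, P (t, i) := by
    intro t ht
    induction ht with
    | refl => exact fun i => hnext _ d.2 i h0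
    | tail _ hs ih =>
      obtain ⟨i, j, hij⟩ := hs
      intro l
      refine hnext _ j l ?_
      rw [← hij]
      exact hg _ (ih i)
  exact key c.1 (hX.2 d.1 c.1) c.2

/-- The words "translate, then turn" already reach every corner, because `n` is `r ^ 2` times a
translation and translations can be moved past powers of `r`. -/
theorem IsConnected.exists_r_pow_transl (hX : X.IsConnected)
    (h : TilingRelations X.rotPerm X.nextPerm) (d c : X.Face × Fin 3) :
    ∃ (k : ℕ) (a : ℤ × ℤ), c = (X.rotPerm ^ k) (transl X.rotPerm X.nextPerm a d) := by
  have hn : ∀ c, (∃ (k : ℕ) (a : ℤ × ℤ),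
      c = (X.rotPerm ^ k) (transl X.rotPerm X.nextPerm a d)) → ∃ (k : ℕ) (a : ℤ × ℤ),
      X.nextPerm c = (X.rotPerm ^ k) (transl X.rotPerm X.nextPerm a d) := by
    rintro _ ⟨k, a, rfl⟩
    refine ⟨2 + k, mulDelta^[k] (1, 0) + a, ?_⟩
    rw [h.transl_add, ← Equiv.Perm.mul_apply, ← Equiv.Perm.mul_apply, ← Equiv.Perm.mul_apply]
    congr 1
    rw [pow_add, mul_assoc (_ ^ 2), ← mul_assoc (X.rotPerm ^ k) (transl _ _ _), ← h.transl_mul_r_pow]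
    nth_rw 1 [eq_sq_mul_transl X.rotPerm X.nextPerm]
    simp only [mul_assoc]
  refine hX.dart_induction d ⟨0, 0, by simp [transl_zero]⟩ hn ?_ c
  intro c hc
  obtain ⟨k, a, hk⟩ := hn c hc
  refine ⟨k + 1, a, ?_⟩
  rw [pow_succ', Equiv.Perm.mul_apply, ← hk, ← gluePerm_apply, ← rotPerm_mul_nextPerm,
    Equiv.Perm.mul_apply]

theorem Iso.map_nextPerm (e : Iso X Y) (c : X.Face × Fin 3) :
    e.toEquiv (X.nextPerm c) = Y.nextPerm (e.toEquiv c) :=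
  e.map_next c.1 c.2 _ _ rfl

theorem Iso.map_rotPerm (e : Iso X Y) (c : X.Face × Fin 3) :
    e.toEquiv (X.rotPerm c) = Y.rotPerm (e.toEquiv c) := by
  obtain ⟨c, rfl⟩ := X.nextPerm.surjective c
  rw [e.map_nextPerm, ← Equiv.Perm.mul_apply, ← Equiv.Perm.mul_apply, rotPerm_mul_nextPerm,
    rotPerm_mul_nextPerm, gluePerm_apply, gluePerm_apply, e.map_glue]

theorem Iso.permCongr_rotPerm (e : Iso X Y) : e.toEquiv.permCongrHom X.rotPerm = Y.rotPerm := by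
  ext1 c
  simp [Equiv.permCongrHom, Equiv.permCongr_apply, e.map_rotPerm]

theorem Iso.permCongr_nextPerm (e : Iso X Y) :
    e.toEquiv.permCongrHom X.nextPerm = Y.nextPerm := by
  ext1 c
  simp [Equiv.permCongrHom, Equiv.permCongr_apply, e.map_nextPerm]

theorem Iso.map_transl (e : Iso X Y) (b : ℤ × ℤ) (c : X.Face × Fin 3) :
    e.toEquiv (transl X.rotPerm X.nextPerm b c) =
      transl Y.rotPerm Y.nextPerm b (e.toEquiv c) := by
  rw [← e.permCongr_rotPerm, ← e.permCongr_nextPerm]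
  have := _root_.map_transl e.toEquiv.permCongrHom.toMonoidHom X.rotPerm X.nextPerm b
  simp only [MulEquiv.toMonoidHom_eq_coe, MonoidHom.coe_coe] at this
  rw [← this]
  simp [Equiv.permCongrHom, Equiv.permCongr_apply]

theorem Iso.stab_eq (e : Iso X Y) (hX : TilingRelations X.rotPerm X.nextPerm)
    (hY : TilingRelations Y.rotPerm Y.nextPerm) (c : X.Face × Fin 3) :
    hY.stab (e.toEquiv c) = hX.stab c := by
  ext b
  rw [hX.mem_stab, hY.mem_stab, ← e.map_transl, e.toEquiv.injective.eq_iff]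

end Triangulation

namespace TriangulationsOfType34

theorem degree_eq (X : TriangulationsOfType34) (v : X.1.Vertex) :
    X.1.degree v = 3 ∨ X.1.degree v = 6 := by
  by_cases h : X.1.IsSingular v
  · exact Or.inl (X.2.2.2 v h)
  · right
    simp only [Triangulation.IsSingular, Triangulation.curvature, not_not] at h
    omega

theorem rotPerm_pow_six (X : TriangulationsOfType34) : X.1.rotPerm ^ 6 = 1 := by
  ext1 c
  rw [Equiv.Perm.one_apply, Triangulation.rotPerm_pow_eq_iff]
  rcases X.degree_eq (X.1.vertexOf c) with h | h <;> norm_num [h]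

theorem relations (X : TriangulationsOfType34) :
    TilingRelations X.1.rotPerm X.1.nextPerm :=
  Triangulation.tilingRelations X.rotPerm_pow_six

theorem rotPerm_sq_ne (X : TriangulationsOfType34) (c : X.1.Face × Fin 3) :
    (X.1.rotPerm ^ 2) c ≠ c := by
  rw [Ne, Triangulation.rotPerm_pow_eq_iff]
  rcases X.degree_eq (X.1.vertexOf c) with h | h <;> (rw [h]; decide)

theorem exists_rotPerm_cube (X : TriangulationsOfType34) :
    ∃ c : X.1.Face × Fin 3, (X.1.rotPerm ^ 3) c = c := by
  have h : Nonempty {v : X.1.Vertex // X.1.IsSingular v} :=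
    (Nat.card_pos_iff.mp (by rw [X.2.2.1]; norm_num)).1
  obtain ⟨v, hv⟩ := h
  induction v using Quotient.inductionOn with | h c => ?_
  refine ⟨c, ?_⟩
  rw [Triangulation.rotPerm_pow_eq_iff]
  exact (X.2.2.2 _ hv).dvd

end TriangulationsOfType34

/-! ### Counting corners and the Euler characteristic -/

namespace Triangulation

theorem two_mul_card_edge (X : Triangulation) :
    2 * Nat.card X.Edge = 3 * Nat.card X.Face := by
  classical
  have := X.finite_face
  have hE : Finite X.Edge := Quotient.finite _
  have := Fintype.ofFinite X.Edge
  let edgeOf : X.Face × Fin 3 → X.Edge := Quotient.mk (Equiv.Perm.SameCycle.setoid X.gluePerm)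
  have h := Nat.card_congr (Equiv.sigmaFiberEquiv edgeOf)
  rw [Nat.card_prod, Nat.card_fin, Nat.card_sigma] at h
  have h2 : ∀ e, Nat.card {s // edgeOf s = e} = 2 := by
    intro e
    induction e using Quotient.inductionOn with | h s => ?_
    rw [← Set.ncard_pair (X.glue_ne s)]
    refine Nat.card_congr (Equiv.subtypeEquivRight ?_)
    intro s'
    refine Iff.symm (Iff.trans ?_ Quotient.eq.symm)
    constructor
    · rintro (rfl | rfl)
      · exact ⟨1, by rw [zpow_one]; exact X.glue_glue s⟩
      · exact ⟨0, rfl⟩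
    · rintro ⟨k, hk⟩
      obtain ⟨m, rfl | rfl⟩ := k.even_or_odd'
      · right
        rw [zpow_mul, zpow_ofNat, gluePerm_sq] at hk
        simpa using hk
      · left
        rw [zpow_add, zpow_mul, zpow_ofNat, gluePerm_sq] at hk
        have hs : X.glue s' = s := by rw [← gluePerm_apply]; simpa using hk
        change s' = _
        rw [← hs, X.glue_glue]
  rw [mul_comm 3, ← h, Finset.sum_congr rfl (fun e _ => h2 e), Finset.sum_const, Finset.card_univ,
    ← Nat.card_eq_fintype_card, smul_eq_mul, mul_comm]

/-- Count corners by vertex: six at each vertex, with a defect of three at each of the four singular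
ones. -/
theorem three_mul_card_face (X : Triangulation) (h36 : ∀ v, X.degree v = 3 ∨ X.degree v = 6)
    (h4 : Nat.card {v : X.Vertex // X.IsSingular v} = 4) :
    3 * Nat.card X.Face + 12 = 6 * Nat.card X.Vertex := by
  classical
  have := X.finite_face
  have hV : Finite X.Vertex := Quotient.finite _
  have := Fintype.ofFinite X.Vertex
  have h := Nat.card_congr (Equiv.sigmaFiberEquiv X.vertexOf)
  rw [Nat.card_prod, Nat.card_fin, Nat.card_sigma] at h
  have h1 : ∀ v, Nat.card {c // X.vertexOf c = v} + 3 * (if X.IsSingular v then 1 else 0) = 6 := by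
    intro v
    change X.degree v + _ = 6
    rcases h36 v with h | h <;> simp [IsSingular, curvature, h]
  have h2 := Finset.sum_congr (rfl : (Finset.univ : Finset X.Vertex) = Finset.univ)
    (fun v _ => h1 v)
  rw [Finset.sum_add_distrib, h, ← Finset.mul_sum, Finset.sum_boole, Finset.sum_const,
    Finset.card_univ, ← Fintype.card_subtype, ← Nat.card_eq_fintype_card, h4,
    ← Nat.card_eq_fintype_card] at h2
  simp only [Nat.cast_ofNat, smul_eq_mul] at h2
  omega

theorem euler_char_eq_two (X : Triangulation) (h36 : ∀ v, X.degree v = 3 ∨ X.degree v = 6)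
    (h4 : Nat.card {v : X.Vertex // X.IsSingular v} = 4) :
    (Nat.card X.Vertex : ℤ) - (Nat.card X.Edge : ℤ) + (Nat.card X.Face : ℤ) = 2 := by
  have h1 := X.two_mul_card_edge
  have h2 := X.three_mul_card_face h36 h4
  omega

end Triangulation

/-! ## The triangulation of the quotient of the plane by a lattice and a half-turn -/

/-- The vertices of the triangle `0, 1, δ`. -/
def cornerOffset : Fin 3 → ℤ × ℤ := ![(0, 0), (1, 0), (0, 1)]

/-- The half-turn about the midpoint of side `i` of the triangle with base `a`, followed by `-1`,
exchanges `a` and `sideOffset i - a`. -/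
def sideOffset (i : Fin 3) : ℤ × ℤ := -(cornerOffset i + cornerOffset (i + 1))

/-- The midpoint of a side is not a vertex of the tiling. This parity makes the gluing
fixed-point-free on the quotient by an even lattice. -/
theorem sideOffset_ne_add (i : Fin 3) (a : ℤ × ℤ) : sideOffset i ≠ a + a := by
  intro h
  have h1 := congrArg Prod.fst h
  have h2 := congrArg Prod.snd h
  fin_cases i <;> simp [sideOffset, cornerOffset] at h1 h2 <;> omega

/-- The quotient of the Eisenstein tiling by the group generated by the translations by `L` and by
the half-turn about `0`.  Every triangle of the tiling is equivalent to a triangle `a, a + 1, a + δ`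
that is unique modulo `L`. -/
def latticeTriangulation (L : AddSubgroup (ℤ × ℤ)) (hfin : Finite ((ℤ × ℤ) ⧸ L))
    (heven : ∀ b ∈ L, ∃ a, b = a + a) : Triangulation where
  Face := (ℤ × ℤ) ⧸ L
  finite_face := hfin
  glue s := ((sideOffset s.2 : ℤ × ℤ) - s.1, s.2)
  glue_glue s := by simp
  glue_ne := by
    rintro ⟨a, i⟩ h
    induction a using QuotientAddGroup.induction_on with | H a => ?_
    have h1 := congrArg Prod.fst h
    simp only [← QuotientAddGroup.mk_sub] at h1
    obtain ⟨c, hc⟩ := heven _ (QuotientAddGroup.eq.mp h1)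
    refine sideOffset_ne_add i (a - c) ?_
    have hd : sideOffset i = a + a - (-(sideOffset i - a) + a) := by abel
    rw [hd, hc]
    abel

section latticeTriangulation

variable (L : AddSubgroup (ℤ × ℤ)) (hfin : Finite ((ℤ × ℤ) ⧸ L))
  (heven : ∀ b ∈ L, ∃ a, b = a + a)

local notation "M" => latticeTriangulation L hfin heven

/-- The position of a corner in the plane. -/
def cornerPos (c : (M).Face × Fin 3) : (ℤ × ℤ) ⧸ L :=
  let a : (ℤ × ℤ) ⧸ L := c.1
  a + (cornerOffset c.2 : ℤ × ℤ)

theorem cornerPos_mk (a : (ℤ × ℤ) ⧸ L) (i : Fin 3) :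
    cornerPos L hfin heven (a, i) = a + (cornerOffset i : ℤ × ℤ) := rfl

variable {L hfin heven}

theorem corner_ext {c c' : (M).Face × Fin 3}
    (h1 : cornerPos L hfin heven c = cornerPos L hfin heven c')
    (h2 : c.2 = c'.2) : c = c' := by
  obtain ⟨(a : (ℤ × ℤ) ⧸ L), i⟩ := c
  obtain ⟨(a' : (ℤ × ℤ) ⧸ L), i'⟩ := c'
  obtain rfl : i = i' := h2
  have h3 : a = a' := add_right_cancel (b := ((cornerOffset i : ℤ × ℤ) : (ℤ × ℤ) ⧸ L)) h1
  rw [h3]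

theorem rotPerm_snd (c : (M).Face × Fin 3) : ((M).rotPerm c).2 = c.2 - 1 := by
  rw [Triangulation.rotPerm_apply]; rfl

/-- Crossing a side leads to a triangle of the opposite orientation, which the half-turn about `0`
replaces by one with a base `a, a + 1, a + δ`. Hence the sign. -/
theorem cornerPos_rotPerm (c : (M).Face × Fin 3) :
    cornerPos L hfin heven ((M).rotPerm c) = -cornerPos L hfin heven c := by
  obtain ⟨(a : (ℤ × ℤ) ⧸ L), i⟩ := c
  rw [Triangulation.rotPerm_apply]
  change ((sideOffset (i - 1) : ℤ × ℤ) : (ℤ × ℤ) ⧸ L) - a + (cornerOffset (i - 1) : ℤ × ℤ) =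
    -(a + (cornerOffset i : ℤ × ℤ))
  rw [sideOffset]
  simp only [sub_add_cancel, QuotientAddGroup.mk_neg, QuotientAddGroup.mk_add]
  abel

theorem rotPerm_pow_snd (c : (M).Face × Fin 3) (k : ℕ) :
    (((M).rotPerm ^ k) c).2 = c.2 - k • (1 : Fin 3) := by
  induction k with
  | zero => simp
  | succ k ih => rw [pow_succ', Equiv.Perm.mul_apply, rotPerm_snd, ih, succ_nsmul, sub_sub]

theorem cornerPos_rotPerm_pow (c : (M).Face × Fin 3) (k : ℕ) :
    cornerPos L hfin heven (((M).rotPerm ^ k) c) = (-1) ^ k • cornerPos L hfin heven c := by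
  induction k with
  | zero => simp
  | succ k ih => rw [pow_succ', Equiv.Perm.mul_apply, cornerPos_rotPerm, ih, pow_succ']; simp

theorem latticeTriangulation_rotPerm_pow_six : (M).rotPerm ^ 6 = 1 := by
  ext1 c
  refine corner_ext ?_ ?_
  · rw [cornerPos_rotPerm_pow]; simp
  · rw [rotPerm_pow_snd, show 6 • (1 : Fin 3) = 0 from rfl, sub_zero]; rfl

theorem latticeTriangulation_rotPerm_sq_ne (c : (M).Face × Fin 3) : ((M).rotPerm ^ 2) c ≠ c := by
  intro h
  have := congrArg Prod.snd h
  rw [rotPerm_pow_snd] at this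
  revert this
  generalize c.2 = i
  revert i
  decide

theorem latticeTriangulation_degree (v : (M).Vertex) : (M).degree v = 3 ∨ (M).degree v = 6 := by
  induction v using Quotient.inductionOn with | h c => ?_
  change (M).degree ((M).vertexOf c) = 3 ∨ (M).degree ((M).vertexOf c) = 6
  have h6 : (M).degree ((M).vertexOf c) ∣ 6 := by
    rw [← Triangulation.rotPerm_pow_eq_iff, latticeTriangulation_rotPerm_pow_six]; rfl
  have h2 : ¬ (M).degree ((M).vertexOf c) ∣ 2 := by
    rw [← Triangulation.rotPerm_pow_eq_iff]
    exact latticeTriangulation_rotPerm_sq_ne c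
  have := Nat.le_of_dvd (by norm_num) h6
  interval_cases (M).degree ((M).vertexOf c) <;> simp_all

/-- Degree 3 means that the cube of the rotation fixes the corner. The cube restores the index and
negates the position. -/
theorem latticeTriangulation_isSingular_iff (c : (M).Face × Fin 3) :
    (M).IsSingular ((M).vertexOf c) ↔
      cornerPos L hfin heven c = -cornerPos L hfin heven c := by
  have h1 : (M).IsSingular ((M).vertexOf c) ↔ (M).degree ((M).vertexOf c) ∣ 3 := by
    rcases latticeTriangulation_degree ((M).vertexOf c) with h | h <;>
      simp [Triangulation.IsSingular, Triangulation.curvature, h]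
  rw [h1, ← Triangulation.rotPerm_pow_eq_iff]
  have h3 : cornerPos L hfin heven (((M).rotPerm ^ 3) c) = -cornerPos L hfin heven c := by
    rw [cornerPos_rotPerm_pow]; simp [pow_succ]
  constructor
  · intro h
    rw [← h3, h]
  · intro h
    refine corner_ext (h3.trans h.symm) ?_
    rw [rotPerm_pow_snd, show 3 • (1 : Fin 3) = 0 from rfl, sub_zero]

theorem cornerPos_of_sameCycle {c c' : (M).Face × Fin 3} (h : (M).rotPerm.SameCycle c c') :
    cornerPos L hfin heven c' = cornerPos L hfin heven c ∨
      cornerPos L hfin heven c' = -cornerPos L hfin heven c := by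
  obtain ⟨k, -, rfl⟩ := h.exists_pow_eq'
  rw [cornerPos_rotPerm_pow]
  rcases neg_one_pow_eq_or ℤ k with h | h <;> simp [h]

/-- At a two-torsion position the rotation only lowers the index by one, so it runs through all
three corners there. -/
theorem sameCycle_of_cornerPos {c c' : (M).Face × Fin 3}
    (h : cornerPos L hfin heven c' = cornerPos L hfin heven c)
    (h2 : cornerPos L hfin heven c = -cornerPos L hfin heven c) :
    (M).rotPerm.SameCycle c c' := by
  have hk : ∀ i j : Fin 3, ∃ k : ℕ, i - k • (1 : Fin 3) = j := by
    intro i j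
    refine ⟨(i - j).val, ?_⟩
    revert i j
    decide
  obtain ⟨k, hk⟩ := hk c.2 c'.2
  refine ⟨k, ?_⟩
  rw [zpow_natCast]
  refine corner_ext ?_ (by rw [rotPerm_pow_snd, hk])
  rw [cornerPos_rotPerm_pow, h]
  rcases neg_one_pow_eq_or ℤ k with h | h
  · simp [h]
  · simp [h, ← h2]

theorem card_singular_eq_card_two_torsion :
    Nat.card {v : (M).Vertex // (M).IsSingular v} = Nat.card {w : (ℤ × ℤ) ⧸ L // w = -w} := by
  have hpos : ∀ w : (ℤ × ℤ) ⧸ L, cornerPos L hfin heven (w, 0) = w := by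
    intro w
    have : ((cornerOffset 0 : ℤ × ℤ) : (ℤ × ℤ) ⧸ L) = 0 := rfl
    rw [cornerPos_mk, this, add_zero]
  symm
  refine Nat.card_congr (Equiv.ofBijective (fun w => ⟨(M).vertexOf (w.1, 0), ?_⟩) ⟨?_, ?_⟩)
  · rw [latticeTriangulation_isSingular_iff, hpos]
    exact w.2
  · rintro ⟨w, hw⟩ ⟨w', hw'⟩ h
    have h1 := cornerPos_of_sameCycle (Triangulation.vertexOf_eq_iff.mp (congrArg Subtype.val h))
    rw [hpos, hpos, ← hw, or_self] at h1
    exact Subtype.ext h1.symm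
  · rintro ⟨v, hv⟩
    induction v using Quotient.inductionOn with | h c => ?_
    have h1 := (latticeTriangulation_isSingular_iff c).mp hv
    refine ⟨⟨cornerPos L hfin heven c, h1⟩, Subtype.ext ?_⟩
    refine (Triangulation.vertexOf_eq_iff.mpr (sameCycle_of_cornerPos ?_ h1)).symm
    rw [hpos]

end latticeTriangulation

/-- The number of points of order two of a torus that is the quotient by an even lattice. -/
theorem card_two_torsion (L : AddSubgroup (ℤ × ℤ)) (hfin : Finite ((ℤ × ℤ) ⧸ L))
    (heven : ∀ b ∈ L, ∃ a, b = a + a) : Nat.card {w : (ℤ × ℤ) ⧸ L // w = -w} = 4 := by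
  let f : (ℤ × ℤ) ⧸ L →+ (ℤ × ℤ) ⧸ L := nsmulAddMonoidHom 2
  let p : ℤ × ℤ →+ ZMod 2 × ZMod 2 :=
    (Int.castAddHom (ZMod 2)).prodMap (Int.castAddHom (ZMod 2))
  have h1 : Nat.card {w : (ℤ × ℤ) ⧸ L // w = -w} = Nat.card f.ker := by
    refine Nat.card_congr (Equiv.subtypeEquivRight ?_)
    intro w
    change _ ↔ 2 • w = 0
    rw [two_nsmul, eq_neg_iff_add_eq_zero]
  -- The preimage of the doubled torus is `2ℤ² + L`, which equals 2ℤ² because `L` is even; here `p`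
  -- is reduction modulo 2.
  have h2 : f.range.comap (QuotientAddGroup.mk' L) = p.ker := by
    ext b
    have hp : b ∈ p.ker ↔ ((b.1 : ZMod 2) = 0 ∧ (b.2 : ZMod 2) = 0) := by
      rw [AddMonoidHom.mem_ker, Prod.ext_iff]; rfl
    rw [hp, ZMod.intCast_zmod_eq_zero_iff_dvd, ZMod.intCast_zmod_eq_zero_iff_dvd]
    constructor
    · rintro ⟨w, hw⟩
      induction w using QuotientAddGroup.induction_on with | H a => ?_
      change 2 • (a : (ℤ × ℤ) ⧸ L) = b at hw
      rw [two_nsmul, ← QuotientAddGroup.mk_add, QuotientAddGroup.eq] at hw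
      obtain ⟨c, hc⟩ := heven _ hw
      rw [neg_add_eq_iff_eq_add] at hc
      rw [hc]
      constructor
      · exact ⟨a.1 + c.1, by simp; ring⟩
      · exact ⟨a.2 + c.2, by simp; ring⟩
    · rintro ⟨⟨x, hx⟩, ⟨y, hy⟩⟩
      refine ⟨((x, y) : ℤ × ℤ), ?_⟩
      change 2 • (((x, y) : ℤ × ℤ) : (ℤ × ℤ) ⧸ L) = b
      rw [two_nsmul, ← QuotientAddGroup.mk_add]
      congr 1
      ext
      · rw [hx]; simp; ring
      · rw [hy]; simp; ring
  have h3 : f.range.index = 4 := by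
    rw [← AddSubgroup.index_comap_of_surjective (f := QuotientAddGroup.mk' L) f.range
      (QuotientAddGroup.mk'_surjective L), h2, AddSubgroup.index_ker,
      AddMonoidHom.range_eq_top.mpr]
    · simp
    · exact Prod.map_surjective.mpr ⟨ZMod.intCast_surjective, ZMod.intCast_surjective⟩
  -- For an endomorphism of a finite group, the kernel has as many elements as the range has cosets,
  -- here four.
  have h4 := f.ker.card_mul_index
  have h5 := f.range.card_mul_index
  rw [AddSubgroup.index_ker] at h4
  have h6 : 0 < Nat.card f.range := Nat.card_pos
  rw [h1, ← h3]
  refine Nat.eq_of_mul_eq_mul_right h6 ?_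
  rw [h4, mul_comm, h5]

/-- Crossing side `i` and then side `j` translates the base by `sideOffset j - sideOffset i`. Among
these differences are `±1` and `±δ`, which generate all translations. -/
theorem latticeTriangulation_isConnected (L : AddSubgroup (ℤ × ℤ)) (hfin : Finite ((ℤ × ℤ) ⧸ L))
    (heven : ∀ b ∈ L, ∃ a, b = a + a) : (latticeTriangulation L hfin heven).IsConnected := by
  refine ⟨⟨((0 : ℤ × ℤ) : (ℤ × ℤ) ⧸ L)⟩, ?_⟩
  intro t
  let R : (ℤ × ℤ) ⧸ L → Prop := Relation.ReflTransGen (fun a b => ∃ i j,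
    (latticeTriangulation L hfin heven).glue (a, i) = (b, j)) t
  have hs : ∀ a (i : Fin 3), R a → R ((sideOffset i : ℤ × ℤ) - a) :=
    fun a i h => h.tail ⟨i, i, rfl⟩
  have hss : ∀ (a : (ℤ × ℤ) ⧸ L) (i j : Fin 3) (b : ℤ × ℤ), sideOffset j - sideOffset i = b →
      R a → R (a + b) := by
    rintro a i j b rfl h
    have := hs _ j (hs _ i h)
    rwa [sub_sub_eq_add_sub, add_comm, add_sub_assoc, ← QuotientAddGroup.mk_sub] at this
  have h1 : ∀ (x : ℤ) a, R a → R (a + ((x, 0) : ℤ × ℤ)) := by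
    intro x a h
    induction x using Int.induction_on with
    | zero => rwa [show (((0 : ℤ), (0 : ℤ)) : ℤ × ℤ) = 0 from rfl, QuotientAddGroup.mk_zero, add_zero]
    | succ x ih =>
      have := hss _ 1 2 (1, 0) rfl ih
      rwa [add_assoc, ← QuotientAddGroup.mk_add, Prod.mk_add_mk, add_zero] at this
    | pred x ih =>
      have := hss _ 2 1 (-1, 0) rfl ih
      rwa [add_assoc, ← QuotientAddGroup.mk_add, Prod.mk_add_mk, add_zero] at this
  have h2 : ∀ (y : ℤ) a, R a → R (a + ((0, y) : ℤ × ℤ)) := by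
    intro x a h
    induction x using Int.induction_on with
    | zero => rwa [show (((0 : ℤ), (0 : ℤ)) : ℤ × ℤ) = 0 from rfl, QuotientAddGroup.mk_zero, add_zero]
    | succ x ih =>
      have := hss _ 1 0 (0, 1) rfl ih
      rwa [add_assoc, ← QuotientAddGroup.mk_add, Prod.mk_add_mk, add_zero] at this
    | pred x ih =>
      have := hss _ 0 1 (0, -1) rfl ih
      rwa [add_assoc, ← QuotientAddGroup.mk_add, Prod.mk_add_mk, add_zero] at this
  intro t'
  change R t'
  let a : (ℤ × ℤ) ⧸ L := t
  let a' : (ℤ × ℤ) ⧸ L := t'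
  obtain ⟨b, hb⟩ := QuotientAddGroup.mk_surjective (a' - a)
  have := h2 b.2 _ (h1 b.1 a Relation.ReflTransGen.refl)
  rw [add_assoc, ← QuotientAddGroup.mk_add, Prod.mk_add_mk, add_zero, zero_add, hb] at this
  rwa [add_sub_cancel] at this

theorem latticeTriangulation_type34 (L : AddSubgroup (ℤ × ℤ)) (hfin : Finite ((ℤ × ℤ) ⧸ L))
    (heven : ∀ b ∈ L, ∃ a, b = a + a) :
    let X := latticeTriangulation L hfin heven
    X.IsSphere ∧ Nat.card {v : X.Vertex // X.IsSingular v} = 4 ∧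
      ∀ v : X.Vertex, X.IsSingular v → X.degree v = 3 := by
  intro X
  have h4 : Nat.card {v : X.Vertex // X.IsSingular v} = 4 := by
    rw [card_singular_eq_card_two_torsion, card_two_torsion L hfin heven]
  refine ⟨⟨latticeTriangulation_isConnected L hfin heven,
    X.euler_char_eq_two latticeTriangulation_degree h4⟩, h4, ?_⟩
  intro v hv
  rcases latticeTriangulation_degree v with h | h
  · exact h
  · exact absurd (by simp [Triangulation.curvature, X, h]) hv

/-! ### Translation words in the model triangulation -/

theorem Equiv.Perm.zpow_apply_of_semiconj {α β : Type*} [AddCommGroup β] (f : Equiv.Perm α)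
    (g : β → α) (s : β) (h : ∀ a, f (g a) = g (a + s)) (x : ℤ) (a : β) :
    (f ^ x) (g a) = g (a + x • s) := by
  induction x using Int.induction_on generalizing a with
  | zero => simp
  | succ x ih => rw [zpow_add_one, Equiv.Perm.mul_apply, h, ih, add_smul, one_smul]; abel_nf
  | pred x ih =>
    rw [zpow_sub_one, Equiv.Perm.mul_apply, sub_smul, one_smul]
    have : f⁻¹ (g a) = g (a - s) := by rw [Equiv.Perm.inv_eq_iff_eq, h, sub_add_cancel]
    rw [this, ih]
    abel_nf

section

variable {L : AddSubgroup (ℤ × ℤ)} {hfin : Finite ((ℤ × ℤ) ⧸ L)}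
  {heven : ∀ b ∈ L, ∃ a, b = a + a}

local notation "M" => latticeTriangulation L hfin heven

theorem latticeTriangulation_relations : TilingRelations (M).rotPerm (M).nextPerm :=
  Triangulation.tilingRelations latticeTriangulation_rotPerm_pow_six

theorem latticeTriangulation_transl_one (c c' : (M).Face × Fin 3)
    (h1 : cornerPos L hfin heven c' = cornerPos L hfin heven ((M).nextPerm c)) (h2 : c'.2 = c.2) :
    transl (M).rotPerm (M).nextPerm (1, 0) c = c' := by
  refine ((M).rotPerm ^ 2).injective ?_
  rw [← Equiv.Perm.mul_apply, ← eq_sq_mul_transl]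
  refine corner_ext ?_ ?_
  · rw [cornerPos_rotPerm_pow, h1]; simp
  · rw [rotPerm_pow_snd, h2]
    change c.2 + 1 = _
    generalize c.2 = i
    revert i
    decide

/-- In the model, the abstract translation words are actual translations of the base. Consequently
the stabilizer of the base corner gives back `L`. -/
theorem latticeTriangulation_transl (a : (ℤ × ℤ) ⧸ L) (b : ℤ × ℤ) :
    transl (M).rotPerm (M).nextPerm b (a, (0 : Fin 3)) = (a + (b : (ℤ × ℤ) ⧸ L), (0 : Fin 3)) := by
  have hA : ∀ a : (ℤ × ℤ) ⧸ L, transl (M).rotPerm (M).nextPerm (1, 0) (a, (0 : Fin 3)) =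
      (a + (((1, 0) : ℤ × ℤ) : (ℤ × ℤ) ⧸ L), (0 : Fin 3)) := by
    intro a
    refine latticeTriangulation_transl_one _ _ ?_ rfl
    change a + (((1, 0) : ℤ × ℤ) : (ℤ × ℤ) ⧸ L) + (((0, 0) : ℤ × ℤ) : (ℤ × ℤ) ⧸ L) =
      a + (((1, 0) : ℤ × ℤ) : (ℤ × ℤ) ⧸ L)
    exact add_zero _
  have hB : ∀ a : (ℤ × ℤ) ⧸ L, transl (M).rotPerm (M).nextPerm (0, 1) (a, (0 : Fin 3)) =
      (a + (((0, 1) : ℤ × ℤ) : (ℤ × ℤ) ⧸ L), (0 : Fin 3)) := by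
    intro a
    rw [latticeTriangulation_relations.transl_delta, Equiv.Perm.mul_apply, Equiv.Perm.mul_apply]
    refine Equiv.Perm.inv_eq_iff_eq.mpr ?_
    -- The rotated corner has index 2, whose side points along `-δ`, so the unit step from it lowers
    -- the base by `δ`; rotating back, with its sign, turns this into `+δ`.
    have hr : ∀ a : (ℤ × ℤ) ⧸ L, (M).rotPerm (a, (0 : Fin 3)) =
        (-(((0, 1) : ℤ × ℤ) : (ℤ × ℤ) ⧸ L) - a, (2 : Fin 3)) := fun _ => rfl
    refine (congrArg _ (hr a)).trans (Eq.trans ?_ (hr _).symm)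
    refine latticeTriangulation_transl_one _ _ ?_ rfl
    change -(((0, 1) : ℤ × ℤ) : (ℤ × ℤ) ⧸ L) - (a + (((0, 1) : ℤ × ℤ) : (ℤ × ℤ) ⧸ L)) +
      (((0, 1) : ℤ × ℤ) : (ℤ × ℤ) ⧸ L) = -(((0, 1) : ℤ × ℤ) : (ℤ × ℤ) ⧸ L) - a +
      ((0 : ℤ × ℤ) : (ℤ × ℤ) ⧸ L)
    rw [QuotientAddGroup.mk_zero]
    abel
  have h1 : transl (M).rotPerm (M).nextPerm b = transl (M).rotPerm (M).nextPerm (1, 0) ^ b.1 *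
      transl (M).rotPerm (M).nextPerm (0, 1) ^ b.2 := by simp [transl]
  have eA := Equiv.Perm.zpow_apply_of_semiconj _
    (fun a : (ℤ × ℤ) ⧸ L => ((a, (0 : Fin 3)) : (M).Face × Fin 3)) _ hA
  have eB := Equiv.Perm.zpow_apply_of_semiconj _
    (fun a : (ℤ × ℤ) ⧸ L => ((a, (0 : Fin 3)) : (M).Face × Fin 3)) _ hB
  rw [h1, Equiv.Perm.mul_apply]
  refine (congrArg _ (eB b.2 a)).trans ((eA b.1 _).trans ?_)
  have : (b : (ℤ × ℤ) ⧸ L) = b.2 • (((0, 1) : ℤ × ℤ) : (ℤ × ℤ) ⧸ L) +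
      b.1 • (((1, 0) : ℤ × ℤ) : (ℤ × ℤ) ⧸ L) := by
    rw [← QuotientAddGroup.mk_zsmul, ← QuotientAddGroup.mk_zsmul, ← QuotientAddGroup.mk_add]
    congr 1
    ext <;> simp
  rw [this, add_assoc]
  rfl

theorem latticeTriangulation_stab
    (h : TilingRelations (M).rotPerm (M).nextPerm) :
    h.stab (((0 : (ℤ × ℤ) ⧸ L), (0 : Fin 3)) : (M).Face × Fin 3) = L := by
  ext b
  rw [h.mem_stab, latticeTriangulation_transl, zero_add]
  constructor
  · intro hb
    exact (QuotientAddGroup.eq_zero_iff b).mp (congrArg Prod.fst hb)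
  · intro hb
    rw [(QuotientAddGroup.eq_zero_iff b).mpr hb]
    rfl

theorem latticeTriangulation_rotPerm_cube :
    ((M).rotPerm ^ 3) (((0 : (ℤ × ℤ) ⧸ L), (0 : Fin 3)) : (M).Face × Fin 3) =
      ((0 : (ℤ × ℤ) ⧸ L), (0 : Fin 3)) := by
  have h0 : cornerPos L hfin heven ((0 : (ℤ × ℤ) ⧸ L), (0 : Fin 3)) = 0 := add_zero _
  refine corner_ext ?_ ?_
  · rw [cornerPos_rotPerm_pow, h0, smul_zero]
    exact h0.symm
  · rw [rotPerm_pow_snd]; rfl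

end

/-! ### Half-turns and rotations of order three as words -/

namespace TilingRelations

section

variable {G : Type*} [Group G] {r n : G}

theorem inv_mul_r_pow_five (h : TilingRelations r n) : n⁻¹ * r ^ 5 = r * n := by
  have h1 : (r * n)⁻¹ = r * n := by
    apply inv_eq_of_mul_eq_one_right
    rw [← sq, h.mul_sq]
  calc n⁻¹ * r ^ 5 = n⁻¹ * r⁻¹ * r ^ 6 := by group
    _ = (r * n)⁻¹ := by rw [h.r_pow, mul_one, mul_inv_rev]
    _ = r * n := h1

theorem transl_neg_one (h : TilingRelations r n) : transl r n (-1, 0) = n⁻¹ * r ^ 2 := by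
  rw [show ((-1, 0) : ℤ × ℤ) = -(1, 0) from rfl, h.transl_neg, transl_one, mul_inv_rev, inv_inv]

theorem transl_neg_delta (h : TilingRelations r n) :
    transl r n (0, -1) = r⁻¹ * n⁻¹ * r ^ 3 := by
  rw [show ((0, -1) : ℤ × ℤ) = -(0, 1) from rfl, h.transl_neg, h.transl_delta, transl_one]
  group

theorem transl_mul_r_cube_eq_conj (h : TilingRelations r n) :
    transl r n (1, 0) * r ^ 3 = r ^ 3 * (r * n) * (r ^ 3)⁻¹ := by
  rw [h.transl_mul_r_cube, show (-(1, 0) : ℤ × ℤ) = (-1, 0) from rfl, h.transl_neg_one,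
    ← h.inv_mul_r_pow_five]
  group

/-- Crossing side `i` of the base triangle is the half-turn about the midpoint of that side. The
offset is minus the sum of the endpoints because it is read in the frame already turned by `r ^ 3`.
-/
theorem mul_pow_eq_transl_sideOffset (h : TilingRelations r n) (i : Fin 3) :
    r * n * n ^ i.val = n ^ i.val * (transl r n (sideOffset i) * r ^ 3) := by
  have h6 := h.r_pow
  have h3 := h.n_pow
  have h2 := h.mul_sq
  fin_cases i
  · change r * n * n ^ 0 = n ^ 0 * (transl r n (-1, 0) * r ^ 3)
    rw [h.transl_neg_one, ← h.inv_mul_r_pow_five]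
    group
  · change r * n * n ^ 1 = n ^ 1 * (transl r n (-1, -1) * r ^ 3)
    rw [show ((-1, -1) : ℤ × ℤ) = (-1, 0) + (0, -1) from rfl, h.transl_add, h.transl_neg_one,
      h.transl_neg_delta]
    calc r * n * n ^ 1 = r * n ^ 3 * n⁻¹ := by group
      _ = r * n⁻¹ * r ^ 6 := by rw [h3, h6, mul_one, mul_one]
      _ = _ := by group
  · change r * n * n ^ 2 = n ^ 2 * (transl r n (0, -1) * r ^ 3)
    rw [h.transl_neg_delta]
    have hnrn : r = (n * r * n)⁻¹ := by
      refine eq_inv_of_mul_eq_one_left ?_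
      rw [← h2, sq, mul_assoc, mul_assoc]
    calc r * n * n ^ 2 = r * n ^ 3 := by group
      _ = n ^ 3 * (n * r * n)⁻¹ * r ^ 6 := by rw [h3, h6, mul_one, mul_one, one_mul, ← hnrn]
      _ = _ := by group

end

variable {D : Type*} {r n : Equiv.Perm D}

/-- These words are the rotations of order three. Conjugation by the translation by `e` changes `b`
by `(δ² - 1) e`, and `δ² - 1` has norm 3. So it suffices to treat `b = 0, 1, -1`, which give `r ^
2`, `n` and a conjugate of `n`. -/
theorem r_sq_mul_transl_ne (h : TilingRelations r n) (hr : ∀ c, (r ^ 2) c ≠ c)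
    (hn : ∀ c, n c ≠ c) (b : ℤ × ℤ) (d : D) :
    (r ^ 2 * transl r n b) d ≠ d := by
  intro hb
  have key : ∀ e s : ℤ × ℤ, mulDelta (mulDelta e) - e + s = b →
      (r ^ 2 * transl r n s) ((transl r n e)⁻¹ d) = (transl r n e)⁻¹ d := by
    rintro e s rfl
    have h1 : transl r n e * (r ^ 2 * transl r n s) * (transl r n e)⁻¹ =
        r ^ 2 * transl r n (mulDelta (mulDelta e) - e + s) := by
      rw [← mul_assoc, h.transl_mul_r_pow, ← h.transl_neg, mul_assoc, mul_assoc, ← h.transl_add,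
        ← h.transl_add]
      congr 2
      change mulDelta (mulDelta e) + (s + -e) = _
      abel
    rw [← h1, Equiv.Perm.mul_apply, Equiv.Perm.mul_apply] at hb
    rw [Equiv.Perm.eq_inv_iff_eq, hb]
  rw [eq_sq_mul_transl r n] at hn
  -- The multiples of `δ² - 1` are the `b` with `b.1 + 2 * b.2` divisible by 3; the witness for `e`
  -- below solves the resulting linear system.
  obtain ⟨q, hq⟩ : ∃ q, b.1 + 2 * b.2 = 3 * q ∨ b.1 + 2 * b.2 = 3 * q + 1 ∨
    b.1 + 2 * b.2 = 3 * q - 1 := ⟨(b.1 + 2 * b.2 + 1) / 3, by omega⟩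
  have hb0 : ∀ s : ℤ, b.1 + 2 * b.2 = 3 * q + s →
      mulDelta (mulDelta (b.2 - q, -q)) - (b.2 - q, -q) + (s, 0) = b := by
    intro s hs
    rw [mulDelta_mulDelta]
    ext
    · simp; linarith
    · simp
  rcases hq with hq | hq | hq
  · have := key _ _ (hb0 0 (by rw [hq, add_zero]))
    rw [show ((0, 0) : ℤ × ℤ) = 0 from rfl, transl_zero, mul_one] at this
    exact hr _ this
  · exact hn _ (key _ _ (hb0 1 hq))
  · have h1 := key _ _ (hb0 (-1) hq)
    generalize (transl r n (b.2 - q, -q))⁻¹ d = c at h1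
    refine hn ((r ^ 3)⁻¹ c) ?_
    rw [Equiv.Perm.eq_inv_iff_eq, ← Equiv.Perm.mul_apply, ← Equiv.Perm.mul_apply]
    refine Eq.trans (congrArg (fun g : Equiv.Perm D => g c) ?_) h1
    have h3 := h.transl_mul_r_cube (-1, 0)
    rw [show (-(-1, 0) : ℤ × ℤ) = (1, 0) from rfl] at h3
    rw [mul_inv_eq_iff_eq_mul, mul_assoc (r ^ 2), h3, ← mul_assoc, ← mul_assoc, ← pow_add,
      ← pow_add]

/-- The word is a half-turn, and conjugation by translations changes `b` by doubles. The three odd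
classes modulo 2 are those of `1`, `δ`, `δ²`, which powers of `r` conjugate into one another. For `b
= 1` the word is conjugate to `r * n`, which has no fixed point. -/
theorem even_of_half_turn (h : TilingRelations r n) (hg : ∀ c, (r * n) c ≠ c)
    {b : ℤ × ℤ} {d : D} (hb : (transl r n b * r ^ 3) d = d) : ∃ a, b = a + a := by
  have key : ∀ e s : ℤ × ℤ, e + e + s = b →
      (transl r n s * r ^ 3) ((transl r n e)⁻¹ d) = (transl r n e)⁻¹ d := by
    rintro e s rfl
    have h1 : transl r n e * (transl r n s * r ^ 3) * (transl r n e)⁻¹ =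
        transl r n (e + e + s) * r ^ 3 := by
      rw [← h.transl_neg, mul_assoc, mul_assoc, ← h.transl_mul_r_cube, ← mul_assoc, ← mul_assoc,
        ← h.transl_add, ← h.transl_add]
      congr 2
      abel
    rw [← h1, Equiv.Perm.mul_apply, Equiv.Perm.mul_apply] at hb
    rw [Equiv.Perm.eq_inv_iff_eq, hb]
  have hg' : ∀ c, (transl r n (1, 0) * r ^ 3) c ≠ c := by
    intro c hc
    rw [h.transl_mul_r_cube_eq_conj, Equiv.Perm.mul_apply, Equiv.Perm.mul_apply,
      ← Equiv.Perm.eq_inv_iff_eq] at hc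
    exact hg _ hc
  have hk : ∀ k c, (transl r n (mulDelta^[k] (1, 0)) * r ^ 3) c ≠ c := by
    intro k c hc
    refine hg' ((r ^ k) c) ?_
    rw [← Equiv.Perm.mul_apply, mul_assoc, ← pow_add, add_comm, pow_add, ← mul_assoc,
      h.transl_mul_r_pow, mul_assoc, Equiv.Perm.mul_apply, hc]
  obtain ⟨x, y⟩ := b
  obtain ⟨p, hp⟩ := x.even_or_odd'
  obtain ⟨q, hq⟩ := y.even_or_odd'
  rcases hp with rfl | rfl <;> rcases hq with rfl | rfl
  · exact ⟨(p, q), by ext <;> simp <;> ring⟩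
  · refine (hk 1 _ (key (p, q) _ ?_)).elim
    ext <;> simp [mulDelta] <;> ring
  · refine (hk 0 _ (key (p, q) _ ?_)).elim
    ext <;> simp <;> ring
  · refine (hk 2 _ (key (p + 1, q) _ ?_)).elim
    ext <;> simp [mulDelta] <;> ring

end TilingRelations

namespace TriangulationsOfType34

variable (X : TriangulationsOfType34)

theorem even_of_mem_stab {d : X.1.Face × Fin 3} (hd : (X.1.rotPerm ^ 3) d = d) :
    ∀ b ∈ X.relations.stab d, ∃ a, b = a + a := by
  intro b hb
  refine X.relations.even_of_half_turn (d := d) ?_ ?_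
  · rw [Triangulation.rotPerm_mul_nextPerm]
    exact X.1.glue_ne
  · rw [Equiv.Perm.mul_apply, hd]
    exact hb

theorem glue_nextPerm_pow_transl {d : X.1.Face × Fin 3} (hd : (X.1.rotPerm ^ 3) d = d) (i : Fin 3)
    (a : ℤ × ℤ) : X.1.glue ((X.1.nextPerm ^ i.val) (transl X.1.rotPerm X.1.nextPerm a d)) =
      (X.1.nextPerm ^ i.val) (transl X.1.rotPerm X.1.nextPerm (sideOffset i - a) d) := by
  have h := X.relations
  have h1 : transl X.1.rotPerm X.1.nextPerm (sideOffset i - a) d =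
      (transl X.1.rotPerm X.1.nextPerm (sideOffset i) * X.1.rotPerm ^ 3) (transl X.1.rotPerm X.1.nextPerm a d) := by
    rw [sub_eq_add_neg, h.transl_add, Equiv.Perm.mul_apply, Equiv.Perm.mul_apply]
    congr 1
    -- Since `r ^ 3` fixes `d`, translating `d` by `-a` is the same as translating by `a` and then
    -- making a half-turn.
    nth_rw 1 [← hd]
    rw [← Equiv.Perm.mul_apply, h.transl_mul_r_cube, neg_neg, Equiv.Perm.mul_apply]
  rw [h1, ← Triangulation.gluePerm_apply, ← Triangulation.rotPerm_mul_nextPerm,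
    ← Equiv.Perm.mul_apply (_ * _), ← Equiv.Perm.mul_apply (_ ^ _) (_ * _)]
  refine congrArg (fun g : Equiv.Perm (X.1.Face × Fin 3) => g (transl X.1.rotPerm X.1.nextPerm a d)) ?_
  exact h.mul_pow_eq_transl_sideOffset i

end TriangulationsOfType34

/-! ### The developing map -/

namespace TriangulationsOfType34

variable (X : TriangulationsOfType34)

/-- The map from the corners of the tiling modulo the translations that fix a corner `d` to the
corners of `X`. -/
def develop (d : X.1.Face × Fin 3) (c : ((ℤ × ℤ) ⧸ X.relations.stab d) × Fin 3) :
    X.1.Face × Fin 3 :=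
  (X.1.nextPerm ^ c.2.val) (Quotient.lift (fun b => transl X.1.rotPerm X.1.nextPerm b d) (by
    intro a b hab
    have h1 : -a + b ∈ X.relations.stab d := QuotientAddGroup.leftRel_apply.mp hab
    rw [X.relations.mem_stab, X.relations.transl_add, X.relations.transl_neg,
      Equiv.Perm.mul_apply, Equiv.Perm.inv_eq_iff_eq] at h1
    exact h1.symm) c.1)

theorem develop_mk (d : X.1.Face × Fin 3) (b : ℤ × ℤ) (i : Fin 3) :
    X.develop d ((b : (ℤ × ℤ) ⧸ X.relations.stab d), i) =
      (X.1.nextPerm ^ i.val) (transl X.1.rotPerm X.1.nextPerm b d) := rfl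

theorem develop_next (d : X.1.Face × Fin 3) (c : (ℤ × ℤ) ⧸ X.relations.stab d) (i : Fin 3) :
    X.develop d (c, i + 1) = X.1.nextPerm (X.develop d (c, i)) := by
  have hp : X.1.nextPerm ^ (i + 1).val = X.1.nextPerm * X.1.nextPerm ^ i.val := by
    rw [← pow_succ']
    fin_cases i
    · rfl
    · rfl
    · exact (Triangulation.nextPerm_pow_three (X := X.1)).symm
  rw [develop, develop, hp, Equiv.Perm.mul_apply]

/-- Two corners with equal image and different indices would give a rotation of order three that
fixes `d`. With equal indices, the translations differ by an element of the stabilizer. -/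
theorem develop_injective (d : X.1.Face × Fin 3) : Function.Injective (X.develop d) := by
  have h := X.relations
  have hne : ∀ a b : ℤ × ℤ, X.1.nextPerm (transl X.1.rotPerm X.1.nextPerm a d) ≠
      transl X.1.rotPerm X.1.nextPerm b d := by
    intro a b hab
    refine h.r_sq_mul_transl_ne X.rotPerm_sq_ne Triangulation.nextPerm_ne
      (mulDelta^[2] (-b) + ((1, 0) + a)) d ?_
    rw [h.transl_add, ← mul_assoc, ← h.transl_mul_r_pow, h.transl_add, mul_assoc,
      ← mul_assoc (X.1.rotPerm ^ 2), ← eq_sq_mul_transl, Equiv.Perm.mul_apply,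
      Equiv.Perm.mul_apply, hab, h.transl_neg]
    exact (transl X.1.rotPerm X.1.nextPerm b).symm_apply_apply d
  rintro ⟨x, i⟩ ⟨y, j⟩ hxy
  induction x using QuotientAddGroup.induction_on with | H a => ?_
  induction y using QuotientAddGroup.induction_on with | H b => ?_
  have key : ∀ (i : Fin 3) (a b : ℤ × ℤ),
      X.develop d ((a : (ℤ × ℤ) ⧸ h.stab d), i) ≠ X.develop d ((b : (ℤ × ℤ) ⧸ h.stab d), i + 1) := by
    intro i a b hab
    rw [develop_next, develop_mk, develop_mk, ← Equiv.Perm.mul_apply X.1.nextPerm,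
      ← pow_succ', pow_succ, Equiv.Perm.mul_apply, (X.1.nextPerm ^ _).injective.eq_iff] at hab
    exact hne b a hab.symm
  have hij : j = i ∨ j = i + 1 ∨ i = j + 1 := by
    clear hxy key
    revert i j
    decide
  rcases hij with rfl | rfl | rfl
  · rw [develop_mk, develop_mk, (X.1.nextPerm ^ _).injective.eq_iff] at hxy
    refine Prod.ext ?_ rfl
    refine QuotientAddGroup.eq.mpr ?_
    rw [h.mem_stab, h.transl_add, h.transl_neg, Equiv.Perm.mul_apply, Equiv.Perm.inv_eq_iff_eq,
      hxy]
  · exact (key _ _ _ hxy).elim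
  · exact (key _ _ _ hxy.symm).elim

theorem develop_glue {d : X.1.Face × Fin 3} (hd : (X.1.rotPerm ^ 3) d = d)
    (c : (ℤ × ℤ) ⧸ X.relations.stab d) (i : Fin 3) :
    X.develop d ((sideOffset i : ℤ × ℤ) - c, i) = X.1.glue (X.develop d (c, i)) := by
  induction c using QuotientAddGroup.induction_on with | H a => ?_
  rw [← QuotientAddGroup.mk_sub, develop_mk, develop_mk, X.glue_nextPerm_pow_transl hd]

theorem develop_surjective {d : X.1.Face × Fin 3} (hd : (X.1.rotPerm ^ 3) d = d) :
    Function.Surjective (X.develop d) := by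
  refine X.2.1.1.dart_induction d ⟨((0 : ℤ × ℤ), 0), ?_⟩ ?_ ?_
  · rw [develop_mk, transl_zero]; rfl
  · rintro _ ⟨⟨c, i⟩, rfl⟩
    exact ⟨_, X.develop_next d c i⟩
  · rintro _ ⟨⟨c, i⟩, rfl⟩
    exact ⟨_, X.develop_glue hd c i⟩

/-- Every triangulation of the given type is a quotient of the tiling. -/
theorem nonempty_iso {d : X.1.Face × Fin 3} (hd : (X.1.rotPerm ^ 3) d = d)
    (hfin : Finite ((ℤ × ℤ) ⧸ X.relations.stab d))
    (heven : ∀ b ∈ X.relations.stab d, ∃ a, b = a + a) :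
    Nonempty (Triangulation.Iso (latticeTriangulation (X.relations.stab d) hfin heven) X.1) := by
  refine ⟨⟨Equiv.ofBijective (X.develop d) ⟨X.develop_injective d, X.develop_surjective hd⟩,
    ?_, ?_⟩⟩
  · intro t i t' j h
    have := X.develop_next d t i
    rw [show X.develop d (t, i) = (t', j) from h] at this
    exact this
  · rintro ⟨t, i⟩
    exact X.develop_glue hd t i

end TriangulationsOfType34

/-! ### Classification by lattices up to powers of `δ` -/

/-- The quotient of the tiling by a lattice and a half-turn, as a triangulation with four
singular vertices. -/
def latticeType34 (L : AddSubgroup (ℤ × ℤ)) (hfin : Finite ((ℤ × ℤ) ⧸ L))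
    (heven : ∀ b ∈ L, ∃ a, b = a + a) : TriangulationsOfType34 :=
  ⟨latticeTriangulation L hfin heven, latticeTriangulation_type34 L hfin heven⟩

theorem TriangulationsOfType34.exists_lattice (X : TriangulationsOfType34) :
    ∃ L hfin heven, latticeType34 L hfin heven ≈ X := by
  obtain ⟨d, hd⟩ := X.exists_rotPerm_cube
  exact ⟨_, X.relations.stab_finiteIndex d, X.even_of_mem_stab hd,
    X.nonempty_iso hd (X.relations.stab_finiteIndex d) (X.even_of_mem_stab hd)⟩

/-- Two lattices give isomorphic triangulations if and only if they differ by a power of `δ`. -/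
theorem latticeType34_equiv_iff {L L' : AddSubgroup (ℤ × ℤ)} {hfin : Finite ((ℤ × ℤ) ⧸ L)}
    {heven : ∀ b ∈ L, ∃ a, b = a + a} {hfin' : Finite ((ℤ × ℤ) ⧸ L')}
    {heven' : ∀ b ∈ L', ∃ a, b = a + a} :
    latticeType34 L hfin heven ≈ latticeType34 L' hfin' heven' ↔
      ∃ k : ℕ, ∀ b, b ∈ L ↔ mulDelta^[k] b ∈ L' := by
  let X := latticeType34 L hfin heven
  let X' := latticeType34 L' hfin' heven'
  let d : X.1.Face × Fin 3 := ((0 : (ℤ × ℤ) ⧸ L), 0)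
  let d' : X'.1.Face × Fin 3 := ((0 : (ℤ × ℤ) ⧸ L'), 0)
  have hs : X.relations.stab d = L := latticeTriangulation_stab (heven := heven) X.relations
  have hs' : X'.relations.stab d' = L' := latticeTriangulation_stab (heven := heven') X'.relations
  constructor
  · rintro ⟨e⟩
    have h1 := e.stab_eq X.relations X'.relations d
    -- The image of the base corner need not be the base corner; it is reached by a translation and
    -- `k` turns, and only the turns affect its stabilizer.
    obtain ⟨k, a, hk⟩ := X'.2.1.1.exists_r_pow_transl X'.relations d' (e.toEquiv d)
    refine ⟨k, fun b => ?_⟩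
    rw [hs] at h1
    have h2 := X'.relations.mem_stab_r_pow_transl (d := d') k a b
    rw [← hk, hs'] at h2
    rw [← h2]
    exact (SetLike.ext_iff.mp h1 b).symm
  · rintro ⟨k, hk⟩
    -- Develop `X'` from the base corner turned `k` times: it is still fixed by the half-turn, and
    -- its stabilizer is `L`.
    have hd : (X'.1.rotPerm ^ 3) ((X'.1.rotPerm ^ k) d') = (X'.1.rotPerm ^ k) d' := by
      rw [← Equiv.Perm.mul_apply, ← pow_add, add_comm, pow_add, Equiv.Perm.mul_apply,
        show (X'.1.rotPerm ^ 3) d' = d' from latticeTriangulation_rotPerm_cube (heven := heven')]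
    have hL : X'.relations.stab ((X'.1.rotPerm ^ k) d') = L := by
      ext b
      have := X'.relations.mem_stab_r_pow_transl (d := d') k 0 b
      rw [transl_zero, Equiv.Perm.one_apply, hs'] at this
      rw [this, hk]
    have := X'.nonempty_iso hd
    rw [hL] at this
    exact this hfin heven

/-! ## Lattices in the Eisenstein integers -/

/-- The Eisenstein integer with coordinates `b`. -/
noncomputable def eisPoint : ℤ × ℤ →+ ℂ where
  toFun b := b.1 + b.2 * delta
  map_zero' := by simp
  map_add' a b := by simp; ring

theorem eisPoint_apply (b : ℤ × ℤ) : eisPoint b = b.1 + b.2 * delta := rfl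

theorem eisPoint_mem (b : ℤ × ℤ) : eisPoint b ∈ Eis := ⟨b.1, b.2, rfl⟩

theorem exists_eisPoint {w : ℂ} (h : w ∈ Eis) : ∃ b, w = eisPoint b := by
  obtain ⟨x, y, rfl⟩ := h
  exact ⟨(x, y), rfl⟩

theorem delta_re : delta.re = 1 / 2 := by simp [delta_eq]

theorem delta_im : delta.im = Real.sqrt 3 / 2 := by simp [delta_eq]

theorem delta_im_pos : 0 < delta.im := by rw [delta_im]; positivity

/-- `1` and `δ` are linearly independent over the reals. -/
theorem coord_ext {s t s' t' : ℝ} (h : (s : ℂ) + t * delta = s' + t' * delta) :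
    s = s' ∧ t = t' := by
  have h1 := congrArg Complex.re h
  have h2 := congrArg Complex.im h
  simp only [Complex.add_re, Complex.add_im, Complex.re_ofReal_mul, Complex.im_ofReal_mul,
    Complex.ofReal_re, Complex.ofReal_im, zero_add] at h1 h2
  have h3 := mul_right_cancel₀ delta_im_pos.ne' h2
  exact ⟨by rw [h3] at h1; linarith, h3⟩

theorem eisPoint_eq_coord (b : ℤ × ℤ) :
    eisPoint b = ((b.1 : ℝ) : ℂ) + ((b.2 : ℝ) : ℂ) * delta := by
  simp [eisPoint_apply]

theorem eisPoint_injective : Function.Injective eisPoint := by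
  intro a b h
  rw [eisPoint_eq_coord, eisPoint_eq_coord] at h
  obtain ⟨h1, h2⟩ := coord_ext h
  exact Prod.ext (by exact_mod_cast h1) (by exact_mod_cast h2)

theorem eisPoint_mulDelta (b : ℤ × ℤ) : eisPoint (mulDelta b) = delta * eisPoint b := by
  simp only [eisPoint_apply, mulDelta]
  push_cast
  linear_combination -(b.2 : ℂ) * delta_sq

theorem eisPoint_mulDelta_iterate (k : ℕ) (b : ℤ × ℤ) :
    eisPoint (mulDelta^[k] b) = delta ^ k * eisPoint b := by
  induction k with
  | zero => simp
  | succ k ih => rw [Function.iterate_succ_apply', eisPoint_mulDelta, ih, pow_succ']; ring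

theorem delta_pow_three : delta ^ 3 = -1 := by
  linear_combination (delta + 1) * delta_sq

theorem areaNorm_eq (z : ℂ × ℂ) : areaNorm z = (z.1.re * z.2.im - z.1.im * z.2.re) / 2 := by
  simp [areaNorm, areaForm]
  ring

theorem areaNorm_comb (z : ℂ × ℂ) (a b c d : ℤ) :
    areaNorm (a * z.1 + b * z.2, c * z.1 + d * z.2) = ((a * d - b * c : ℤ) : ℝ) * areaNorm z := by
  simp [areaNorm_eq]
  ring

theorem areaNorm_eisPoint (p q : ℤ × ℤ) :
    areaNorm (eisPoint p, eisPoint q) =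
      Real.sqrt 3 / 4 * ((p.1 * q.2 - p.2 * q.1 : ℤ) : ℝ) := by
  simp [areaNorm_eq, eisPoint_apply, delta_re, delta_im]
  ring

/-- The integral combinations of the two components of `z`. -/
def periods (z : ℂ × ℂ) : AddSubgroup ℂ where
  carrier := {w | ∃ m n : ℤ, w = m * z.1 + n * z.2}
  zero_mem' := ⟨0, 0, by simp⟩
  add_mem' := by
    rintro _ _ ⟨m, n, rfl⟩ ⟨m', n', rfl⟩
    exact ⟨m + m', n + n', by push_cast; ring⟩
  neg_mem' := by
    rintro _ ⟨m, n, rfl⟩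
    exact ⟨-m, -n, by push_cast; ring⟩

/-- The coordinates of the Eisenstein integers among the periods of `z`. -/
noncomputable def periodLattice (z : ℂ × ℂ) : AddSubgroup (ℤ × ℤ) := (periods z).comap eisPoint

theorem mem_periodLattice {z : ℂ × ℂ} {b : ℤ × ℤ} :
    b ∈ periodLattice z ↔ ∃ m n : ℤ, eisPoint b = m * z.1 + n * z.2 := Iff.rfl

theorem exists_eisPoint_of_mem_latticeE {z : ℂ × ℂ} (h : z ∈ latticeE) :
    ∃ p q : ℤ × ℤ, z = (eisPoint (p + p), eisPoint (q + q)) := by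
  obtain ⟨a, ha, b, hb, rfl⟩ := h
  obtain ⟨p, rfl⟩ := exists_eisPoint ha
  obtain ⟨q, rfl⟩ := exists_eisPoint hb
  exact ⟨p, q, by rw [map_add, map_add, two_mul, two_mul]⟩

theorem mem_latticeE_of_even (p q : ℤ × ℤ) : (eisPoint (p + p), eisPoint (q + q)) ∈ latticeE :=
  ⟨_, eisPoint_mem p, _, eisPoint_mem q, by rw [map_add, map_add, two_mul, two_mul]⟩

theorem eisPoint_comb (m n : ℤ) (p q : ℤ × ℤ) :
    eisPoint (m • p + n • q) = m * eisPoint p + n * eisPoint q := by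
  rw [map_add, map_zsmul, map_zsmul, zsmul_eq_mul, zsmul_eq_mul]

theorem mem_periodLattice_eisPoint {p q b : ℤ × ℤ} :
    b ∈ periodLattice (eisPoint p, eisPoint q) ↔ ∃ m n : ℤ, b = m • p + n • q := by
  rw [mem_periodLattice]
  simp only [← eisPoint_comb, eisPoint_injective.eq_iff]

theorem even_of_mem_periodLattice {z : ℂ × ℂ} (h : z ∈ latticeE) :
    ∀ b ∈ periodLattice z, ∃ a, b = a + a := by
  obtain ⟨p, q, rfl⟩ := exists_eisPoint_of_mem_latticeE h
  intro b hb
  obtain ⟨m, n, rfl⟩ := mem_periodLattice_eisPoint.mp hb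
  exact ⟨m • p + n • q, by rw [smul_add, smul_add]; abel⟩

theorem card_quotient_periodLattice (p q : ℤ × ℤ) (h : p.1 * q.2 - p.2 * q.1 ≠ 0) :
    Nat.card ((ℤ × ℤ) ⧸ periodLattice (eisPoint p, eisPoint q)) =
      (p.1 * q.2 - p.2 * q.1).natAbs := by
  let f : ℤ × ℤ →ₗ[ℤ] ℤ × ℤ :=
    (LinearMap.toSpanSingleton ℤ (ℤ × ℤ) p).coprod (LinearMap.toSpanSingleton ℤ (ℤ × ℤ) q)
  have hf : ∀ x, f x = x.1 • p + x.2 • q := fun x => by simp [f]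
  have hdet : LinearMap.det f = p.1 * q.2 - p.2 * q.1 := by
    rw [← LinearMap.det_toMatrix (Module.Basis.finTwoProd ℤ), Matrix.det_fin_two]
    simp [LinearMap.toMatrix_apply, hf]
    ring
  have hinj : Function.Injective f := by
    rw [← LinearMap.ker_eq_bot]
    by_contra hk
    exact h (hdet ▸ LinearMap.det_eq_zero_iff_ker_ne_bot.mpr hk)
  have hr : periodLattice (eisPoint p, eisPoint q) = (LinearMap.range f).toAddSubgroup := by
    ext b
    rw [mem_periodLattice_eisPoint, Submodule.mem_toAddSubgroup, LinearMap.mem_range]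
    constructor
    · rintro ⟨m, n, rfl⟩
      exact ⟨(m, n), hf _⟩
    · rintro ⟨x, rfl⟩
      exact ⟨x.1, x.2, hf _⟩
  have := Submodule.natAbs_det_equiv (LinearMap.range f) (LinearEquiv.ofInjective f hinj)
  rw [hr, ← hdet]
  exact this.symm

theorem areaNorm_eq_card {z : ℂ × ℂ} (h : z ∈ EPlus) :
    Finite ((ℤ × ℤ) ⧸ periodLattice z) ∧
      areaNorm z = Real.sqrt 3 / 4 * (Nat.card ((ℤ × ℤ) ⧸ periodLattice z) : ℝ) := by
  obtain ⟨h1, h2⟩ := h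
  obtain ⟨p, q, rfl⟩ := exists_eisPoint_of_mem_latticeE h1
  generalize p + p = p at *
  generalize q + q = q at *
  rw [areaNorm_eisPoint] at h2
  have h3 : 0 < p.1 * q.2 - p.2 * q.1 := by
    exact_mod_cast pos_of_mul_pos_right h2 (by positivity)
  have h4 := card_quotient_periodLattice p q h3.ne'
  refine ⟨Nat.finite_of_card_ne_zero (by rw [h4]; omega), ?_⟩
  rw [areaNorm_eisPoint, h4, Nat.cast_natAbs, abs_of_pos h3]

theorem exists_pos_generator (H : AddSubgroup ℤ) {x : ℤ} (hx : x ∈ H) (h0 : x ≠ 0) :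
    ∃ g : ℤ, 0 < g ∧ g ∈ H ∧ ∀ y ∈ H, ∃ m : ℤ, y = m * g := by
  obtain ⟨a, ha⟩ := Int.subgroup_cyclic H
  rw [← AddSubgroup.zmultiples_eq_closure, ← Int.zmultiples_natAbs] at ha
  subst ha
  refine ⟨_, ?_, AddSubgroup.mem_zmultiples _, ?_⟩
  · obtain ⟨m, hm⟩ := AddSubgroup.mem_zmultiples_iff.mp hx
    have : (a.natAbs : ℤ) ≠ 0 := by
      intro h
      rw [h, smul_zero] at hm
      exact h0 hm.symm
    omega
  · intro y hy
    obtain ⟨m, hm⟩ := AddSubgroup.mem_zmultiples_iff.mp hy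
    exact ⟨m, by rw [← hm, smul_eq_mul]⟩

/-- Hermite normal form: `(p, 0)` generates the part of `L` on the first axis, and `(s, q)` lies
over a generator of its second projection. Both are nonzero because `N • ℤ²` lies in `L`, and
choosing `p, q > 0` makes the basis positively oriented. -/
theorem exists_periodLattice_eq (L : AddSubgroup (ℤ × ℤ)) (hfin : Finite ((ℤ × ℤ) ⧸ L))
    (heven : ∀ b ∈ L, ∃ a, b = a + a) : ∃ z ∈ EPlus, periodLattice z = L := by
  have hN : Nat.card ((ℤ × ℤ) ⧸ L) ≠ 0 := Nat.card_pos.ne'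
  have hmem : ∀ b : ℤ × ℤ, Nat.card ((ℤ × ℤ) ⧸ L) • b ∈ L := by
    intro b
    rw [← QuotientAddGroup.eq_zero_iff, QuotientAddGroup.mk_nsmul, card_nsmul_eq_zero']
  generalize Nat.card ((ℤ × ℤ) ⧸ L) = N at *
  obtain ⟨p, hp, hpL, hp'⟩ := exists_pos_generator (L.comap (AddMonoidHom.inl ℤ ℤ)) (x := N)
    (by simpa using hmem (1, 0)) (by exact_mod_cast hN)
  obtain ⟨q, hq, hqL, hq'⟩ := exists_pos_generator (L.map (AddMonoidHom.snd ℤ ℤ)) (x := N)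
    ⟨_, hmem (0, 1), by simp⟩ (by exact_mod_cast hN)
  obtain ⟨⟨s, _⟩, hsL, rfl⟩ := hqL
  rename_i q
  change 0 < q at hq
  change ((p, 0) : ℤ × ℤ) ∈ L at hpL
  change ((s, q) : ℤ × ℤ) ∈ L at hsL
  refine ⟨(eisPoint (p, 0), eisPoint (s, q)), ⟨?_, ?_⟩, ?_⟩
  · obtain ⟨a, ha⟩ := heven _ hpL
    obtain ⟨b, hb⟩ := heven _ hsL
    rw [ha, hb]
    exact mem_latticeE_of_even a b
  · rw [areaNorm_eisPoint]
    have : (0 : ℤ) < p * q - 0 * s := by simpa using mul_pos hp hq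
    have : (0 : ℝ) < ((p * q - 0 * s : ℤ) : ℝ) := by exact_mod_cast this
    positivity
  · ext b
    rw [mem_periodLattice_eisPoint]
    constructor
    · rintro ⟨m, n, rfl⟩
      exact add_mem (zsmul_mem hpL m) (zsmul_mem hsL n)
    · intro hb
      obtain ⟨n, hn⟩ := hq' b.2 ⟨b, hb, rfl⟩
      change b.2 = n * q at hn
      have h1 : ((b.1 - n * s, 0) : ℤ × ℤ) ∈ L := by
        have := sub_mem hb (zsmul_mem hsL n)
        convert this using 1
        ext
        · simp
        · simp [hn]
      obtain ⟨m, hm⟩ := hp' _ h1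
      refine ⟨m, n, ?_⟩
      ext
      · simp; linarith
      · simp [hn]

/-- Each basis is an integral combination of the other. The two determinants are positive because
both areas are, and their product is 1. -/
theorem exists_sl_of_periodLattice_eq {z z' : EPlus}
    (h : periodLattice z.1 = periodLattice z'.1) : ∃ g : DeltaSL, z'.1 = actC g z.1 := by
  have key : ∀ {z z' : EPlus}, periodLattice z.1 = periodLattice z'.1 → ∃ a b c d : ℤ,
      z'.1 = (a * z.1.1 + b * z.1.2, c * z.1.1 + d * z.1.2) := by
    rintro z ⟨z', h1, h2⟩ h
    obtain ⟨p, q, rfl⟩ := exists_eisPoint_of_mem_latticeE h1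
    have hp : p + p ∈ periodLattice z.1 := by
      rw [h, mem_periodLattice_eisPoint]
      exact ⟨1, 0, by simp⟩
    have hq : q + q ∈ periodLattice z.1 := by
      rw [h, mem_periodLattice_eisPoint]
      exact ⟨0, 1, by simp⟩
    obtain ⟨a, b, hab⟩ := hp
    obtain ⟨c, d, hcd⟩ := hq
    exact ⟨a, b, c, d, Prod.ext hab hcd⟩
  obtain ⟨a, b, c, d, h1⟩ := key h
  obtain ⟨a', b', c', d', h2⟩ := key h.symm
  have e1 := areaNorm_comb z.1 a b c d
  have e2 := areaNorm_comb z'.1 a' b' c' d'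
  rw [← h1] at e1
  rw [← h2] at e2
  have p1 := z.2.2
  have p2 := z'.2.2
  have d1 : 0 < a * d - b * c := by
    rw [e1] at p2
    exact_mod_cast pos_of_mul_pos_left p2 p1.le
  have d2 : 0 < a' * d' - b' * c' := by
    rw [e2] at p1
    exact_mod_cast pos_of_mul_pos_left p1 p2.le
  have d3 : (a' * d' - b' * c') * (a * d - b * c) = 1 := by
    rw [e1, ← mul_assoc] at e2
    have := (mul_eq_right₀ p1.ne').mp e2.symm
    exact_mod_cast this
  have d4 : a * d - b * c = 1 := Int.eq_one_of_mul_eq_one_left d1.le d3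
  refine ⟨(1, ⟨!![a, b; c, d], by rw [Matrix.det_fin_two_of, d4]⟩), ?_⟩
  rw [h1]
  simp [actC]

theorem inv_mul_mem_periods {g : DeltaSL} {z : ℂ × ℂ} {w : ℂ} (h : w ∈ periods (actC g z)) :
    ((g.1 : ℂˣ) : ℂ)⁻¹ * w ∈ periods z := by
  obtain ⟨m, n, rfl⟩ := h
  refine ⟨m * g.2 0 0 + n * g.2 1 0, m * g.2 0 1 + n * g.2 1 1, ?_⟩
  rw [inv_mul_eq_iff_eq_mul₀ (Units.ne_zero _)]
  simp only [actC]
  push_cast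
  ring

theorem mem_periods_actC (g : DeltaSL) (z : EPlus) (w : ℂ) :
    w ∈ periods (actC g z.1) ↔ ((g.1 : ℂˣ) : ℂ)⁻¹ * w ∈ periods z.1 := by
  refine ⟨inv_mul_mem_periods, fun h => ?_⟩
  have hz : actC g⁻¹ (actC g z.1) = z.1 := congrArg Subtype.val (inv_smul_smul g z)
  rw [← hz] at h
  have := inv_mul_mem_periods h
  simpa using this

theorem deltaUnit_isOfFinOrder : IsOfFinOrder deltaUnit := by
  rw [isOfFinOrder_iff_pow_eq_one]
  refine ⟨6, by norm_num, Units.ext ?_⟩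
  rw [Units.val_pow_eq_pow_val, deltaUnit, Units.val_mk0, show 6 = 3 * 2 from rfl, pow_mul,
    delta_pow_three]
  simp

/-- The matrix part only changes the basis and the scalar part turns the lattice. Since `δ` has
finite order, the turn can be written as a natural power, matching the iterates of `mulDelta`. -/
theorem orbit_iff_periodLattice (z z' : EPlus) :
    z' ∈ MulAction.orbit DeltaSL z ↔
      ∃ k : ℕ, ∀ b, b ∈ periodLattice z'.1 ↔ mulDelta^[k] b ∈ periodLattice z.1 := by
  have key : ∀ (g : DeltaSL) (k : ℕ), ((g.1 : ℂˣ)⁻¹ : ℂˣ) = deltaUnit ^ k →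
      ∀ b, b ∈ periodLattice (actC g z.1) ↔ mulDelta^[k] b ∈ periodLattice z.1 := by
    intro g k hk b
    have hk' : ((g.1 : ℂˣ) : ℂ)⁻¹ = delta ^ k := by
      rw [← Units.val_inv_eq_inv_val, hk, Units.val_pow_eq_pow_val]; rfl
    change _ ∈ periods _ ↔ _ ∈ periods _
    rw [mem_periods_actC, eisPoint_mulDelta_iterate, hk']
  constructor
  · rintro ⟨g, rfl⟩
    have h1 : ((g.1 : ℂˣ)⁻¹ : ℂˣ) ∈ Subgroup.zpowers deltaUnit := inv_mem g.1.2
    rw [← deltaUnit_isOfFinOrder.mem_powers_iff_mem_zpowers] at h1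
    obtain ⟨k, hk⟩ := h1
    exact ⟨k, key g k hk.symm⟩
  · rintro ⟨k, hk⟩
    let g : DeltaSL := (⟨(deltaUnit ^ k)⁻¹, inv_mem (pow_mem (Subgroup.mem_zpowers _) k)⟩, 1)
    have h1 := key g k (inv_inv _)
    have h2 : periodLattice (g • z).1 = periodLattice z'.1 := by
      ext b
      rw [hk]
      exact h1 b
    obtain ⟨g', hg'⟩ := exists_sl_of_periodLattice_eq h2
    refine ⟨g' * g, ?_⟩
    change (g' * g) • z = z'
    rw [mul_smul]
    exact Subtype.ext hg'.symm

/-! ## Real coordinates -/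

theorem exists_coord {z : ℂ × ℂ} (h : areaNorm z ≠ 0) (w : ℂ) :
    ∃ s t : ℝ, w = s * z.1 + t * z.2 := by
  have hD : z.1.re * z.2.im - z.1.im * z.2.re ≠ 0 := by
    intro h0
    rw [areaNorm_eq, h0, zero_div] at h
    exact h rfl
  set D := z.1.re * z.2.im - z.1.im * z.2.re with hDdef
  refine ⟨(w.re * z.2.im - w.im * z.2.re) / D, (z.1.re * w.im - z.1.im * w.re) / D, ?_⟩
  apply Complex.ext
  · rw [Complex.add_re, Complex.re_ofReal_mul, Complex.re_ofReal_mul]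
    field_simp
    rw [hDdef]
    ring
  · rw [Complex.add_im, Complex.im_ofReal_mul, Complex.im_ofReal_mul]
    field_simp
    rw [hDdef]
    ring

theorem coord_unique {z : ℂ × ℂ} (h : areaNorm z ≠ 0) {s t s' t' : ℝ}
    (hw : (s : ℂ) * z.1 + t * z.2 = s' * z.1 + t' * z.2) : s = s' ∧ t = t' := by
  have hD : z.1.re * z.2.im - z.1.im * z.2.re ≠ 0 := by
    intro h0
    rw [areaNorm_eq, h0, zero_div] at h
    exact h rfl
  have h1 := congrArg Complex.re hw
  have h2 := congrArg Complex.im hw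
  simp only [Complex.add_re, Complex.add_im, Complex.re_ofReal_mul, Complex.im_ofReal_mul] at h1 h2
  constructor
  · apply mul_right_cancel₀ hD
    linear_combination z.2.im * h1 - z.2.re * h2
  · apply mul_right_cancel₀ hD
    linear_combination z.1.re * h2 - z.1.im * h1

/-- Membership in the standard triangle of the plane. -/
def InTriangle (s t : ℝ) : Prop := 0 ≤ s ∧ 0 ≤ t ∧ s + t ≤ 1

/-- Membership in the set of vertices of the standard triangle of the plane. -/
def IsCornerPoint (s t : ℝ) : Prop :=
  ∃ j : Fin 3, s = ((cornerOffset j).1 : ℝ) ∧ t = ((cornerOffset j).2 : ℝ)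

theorem isCornerPoint_zero : IsCornerPoint 0 0 := ⟨0, by simp [cornerOffset]⟩

theorem isCornerPoint_one : IsCornerPoint 1 0 := ⟨1, by simp [cornerOffset]⟩

theorem isCornerPoint_delta : IsCornerPoint 0 1 := ⟨2, by simp [cornerOffset]⟩

/-- Take fractional parts. A point of the unit square beyond the diagonal is carried into the
triangle by the half-turn about the centre of the square. -/
theorem exists_inTriangle (s t : ℝ) : ∃ (s' t' : ℝ) (m n : ℤ), InTriangle s' t' ∧
    ((s = m + s' ∧ t = n + t') ∨ (s = m - s' ∧ t = n - t')) := by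
  have hs := Int.floor_add_fract s
  have ht := Int.floor_add_fract t
  have hs0 := Int.fract_nonneg s
  have ht0 := Int.fract_nonneg t
  have hs1 := Int.fract_lt_one s
  have ht1 := Int.fract_lt_one t
  by_cases h : Int.fract s + Int.fract t ≤ 1
  · exact ⟨_, _, _, _, ⟨hs0, ht0, h⟩, Or.inl ⟨hs.symm, ht.symm⟩⟩
  · refine ⟨1 - Int.fract s, 1 - Int.fract t, ⌊s⌋ + 1, ⌊t⌋ + 1,
      ⟨by linarith, by linarith, by linarith⟩, Or.inr ⟨?_, ?_⟩⟩
    · push_cast; linarith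
    · push_cast; linarith

/-- A nonzero integral translation moves the triangle to one that meets it at most in a vertex. This
is used for the triangle `0, z₁, z₂` as well as for the unit tiles. -/
theorem InTriangle.eq_or_corner {s t s' t' : ℝ} (h : InTriangle s t) (h' : InTriangle s' t')
    {m n : ℤ} (hm : s - s' = m) (hn : t - t' = n) :
    (m = 0 ∧ n = 0) ∨ (IsCornerPoint s t ∧ IsCornerPoint s' t') := by
  obtain ⟨a1, a2, a3⟩ := h
  obtain ⟨b1, b2, b3⟩ := h'
  have m1 : m ≤ 1 := by
    have : (m : ℝ) ≤ 1 := by linarith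
    exact_mod_cast this
  have m2 : -1 ≤ m := by
    have : (-1 : ℝ) ≤ m := by linarith
    exact_mod_cast this
  have n1 : n ≤ 1 := by
    have : (n : ℝ) ≤ 1 := by linarith
    exact_mod_cast this
  have n2 : -1 ≤ n := by
    have : (-1 : ℝ) ≤ n := by linarith
    exact_mod_cast this
  have c1 : ∀ {x y : ℝ}, x = 0 → y = 0 → IsCornerPoint x y := by
    rintro _ _ rfl rfl; exact isCornerPoint_zero
  have c2 : ∀ {x y : ℝ}, x = 1 → y = 0 → IsCornerPoint x y := by
    rintro _ _ rfl rfl; exact isCornerPoint_one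
  have c3 : ∀ {x y : ℝ}, x = 0 → y = 1 → IsCornerPoint x y := by
    rintro _ _ rfl rfl; exact isCornerPoint_delta
  interval_cases m <;> interval_cases n <;> push_cast at hm hn
  · linarith
  · exact Or.inr ⟨c1 (by linarith) (by linarith), c2 (by linarith) (by linarith)⟩
  · exact Or.inr ⟨c3 (by linarith) (by linarith), c2 (by linarith) (by linarith)⟩
  · exact Or.inr ⟨c1 (by linarith) (by linarith), c3 (by linarith) (by linarith)⟩
  · exact Or.inl ⟨rfl, rfl⟩
  · exact Or.inr ⟨c3 (by linarith) (by linarith), c1 (by linarith) (by linarith)⟩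
  · exact Or.inr ⟨c2 (by linarith) (by linarith), c3 (by linarith) (by linarith)⟩
  · exact Or.inr ⟨c2 (by linarith) (by linarith), c1 (by linarith) (by linarith)⟩
  · linarith

/-- An integral half-turn that relates two points of the triangle is centred at a vertex or at the
midpoint of a side; in the second case both points lie on that side. -/
theorem InTriangle.side_or_corner {s t s' t' : ℝ} (h : InTriangle s t) (h' : InTriangle s' t')
    {m n : ℤ} (hm : s + s' = m) (hn : t + t' = n) :
    (m = 1 ∧ n = 0 ∧ t = 0 ∧ t' = 0) ∨ (m = 1 ∧ n = 1 ∧ s + t = 1 ∧ s' + t' = 1) ∨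
      (m = 0 ∧ n = 1 ∧ s = 0 ∧ s' = 0) ∨ (IsCornerPoint s t ∧ IsCornerPoint s' t') := by
  obtain ⟨a1, a2, a3⟩ := h
  obtain ⟨b1, b2, b3⟩ := h'
  have m1 : m + n ≤ 2 := by
    have : (m : ℝ) + n ≤ 2 := by linarith
    exact_mod_cast this
  have m2 : 0 ≤ m := by
    have : (0 : ℝ) ≤ m := by linarith
    exact_mod_cast this
  have n2 : 0 ≤ n := by
    have : (0 : ℝ) ≤ n := by linarith
    exact_mod_cast this
  have c1 : ∀ {x y : ℝ}, x = 0 → y = 0 → IsCornerPoint x y := by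
    rintro _ _ rfl rfl; exact isCornerPoint_zero
  have c2 : ∀ {x y : ℝ}, x = 1 → y = 0 → IsCornerPoint x y := by
    rintro _ _ rfl rfl; exact isCornerPoint_one
  have c3 : ∀ {x y : ℝ}, x = 0 → y = 1 → IsCornerPoint x y := by
    rintro _ _ rfl rfl; exact isCornerPoint_delta
  have hcases : (m = 0 ∧ n = 0) ∨ (m = 1 ∧ n = 0) ∨ (m = 0 ∧ n = 1) ∨ (m = 1 ∧ n = 1) ∨
      (m = 2 ∧ n = 0) ∨ (m = 0 ∧ n = 2) := by omega
  rcases hcases with ⟨rfl, rfl⟩ | ⟨rfl, rfl⟩ | ⟨rfl, rfl⟩ | ⟨rfl, rfl⟩ | ⟨rfl, rfl⟩ | ⟨rfl, rfl⟩ <;>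
    push_cast at hm hn
  · exact Or.inr (Or.inr (Or.inr
      ⟨c1 (by linarith) (by linarith), c1 (by linarith) (by linarith)⟩))
  · exact Or.inl ⟨rfl, rfl, by linarith, by linarith⟩
  · exact Or.inr (Or.inr (Or.inl ⟨rfl, rfl, by linarith, by linarith⟩))
  · exact Or.inr (Or.inl ⟨rfl, rfl, by linarith, by linarith⟩)
  · exact Or.inr (Or.inr (Or.inr
      ⟨c2 (by linarith) (by linarith), c2 (by linarith) (by linarith)⟩))
  · exact Or.inr (Or.inr (Or.inr
      ⟨c3 (by linarith) (by linarith), c3 (by linarith) (by linarith)⟩))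

/-! ## The quotient of the plane by translations and half-turns -/

/-- Equivalence of points of the plane under the group generated by the translations by `Λ` and the
half-turn about `0`. -/
def halfTurnSetoid (Λ : AddSubgroup ℂ) : Setoid ℂ where
  r x y := x - y ∈ Λ ∨ x + y ∈ Λ
  iseqv :=
    { refl := fun x => Or.inl (by rw [sub_self]; exact zero_mem _)
      symm := by
        rintro x y (h | h)
        · exact Or.inl (by rw [← neg_sub]; exact neg_mem h)
        · exact Or.inr (by rwa [add_comm])
      trans := by
        rintro x y w (h | h) (h' | h')
        · exact Or.inl (by have := add_mem h h'; rwa [sub_add_sub_cancel] at this)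
        · exact Or.inr (by convert add_mem h h' using 1; ring)
        · exact Or.inr (by convert sub_mem h h' using 1; ring)
        · exact Or.inl (by convert sub_mem h h' using 1; ring) }

theorem halfTurnSetoid_iff {Λ : AddSubgroup ℂ} {x y : ℂ} :
    halfTurnSetoid Λ x y ↔ x - y ∈ Λ ∨ x + y ∈ Λ := Iff.rfl

theorem mem_latticeTriangle {z : ℂ × ℂ} {x : ℂ} :
    x ∈ latticeTriangle z ↔ ∃ s t : ℝ, InTriangle s t ∧ x = s * z.1 + t * z.2 := by
  rw [latticeTriangle]
  constructor
  · intro h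
    rw [convexHull_insert ⟨z.1, by simp⟩, convexHull_pair, convexJoin_singleton_left,
      Set.mem_iUnion₂] at h
    obtain ⟨y, ⟨a, b, ha, hb, hab, rfl⟩, ⟨c, d, hc, hd, hcd, rfl⟩⟩ := h
    refine ⟨d * a, d * b, ⟨by positivity, by positivity, ?_⟩, ?_⟩
    · rw [← mul_add, hab]; linarith
    · simp only [Complex.real_smul]
      push_cast
      ring
  · rintro ⟨s, t, ⟨hs, ht, hst⟩, rfl⟩
    have h1 : (0 : ℂ) ∈ convexHull ℝ {0, z.1, z.2} := subset_convexHull _ _ (by simp)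
    have h2 : z.1 ∈ convexHull ℝ {0, z.1, z.2} := subset_convexHull _ _ (by simp)
    have h3 : z.2 ∈ convexHull ℝ {0, z.1, z.2} := subset_convexHull _ _ (by simp)
    have := (convex_convexHull ℝ {0, z.1, z.2}).sum_mem (t := Finset.univ)
      (w := ![1 - s - t, s, t]) (z := ![0, z.1, z.2]) ?_ ?_ ?_
    · simpa [Fin.sum_univ_three] using this
    · intro i _
      fin_cases i
      · change 0 ≤ 1 - s - t; linarith
      · exact hs
      · exact ht
    · simp only [Fin.sum_univ_three, Matrix.cons_val]
      ring
    · intro i _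
      fin_cases i
      exacts [h1, h2, h3]

theorem exists_mem_latticeTriangle {z : ℂ × ℂ} (h : areaNorm z ≠ 0) (w : ℂ) :
    ∃ x : latticeTriangle z, halfTurnSetoid (periods z) w x := by
  obtain ⟨s, t, rfl⟩ := exists_coord h w
  obtain ⟨s', t', m, n, h', hc⟩ := exists_inTriangle s t
  refine ⟨⟨_, mem_latticeTriangle.mpr ⟨s', t', h', rfl⟩⟩, ?_⟩
  rcases hc with ⟨rfl, rfl⟩ | ⟨rfl, rfl⟩
  · exact Or.inl ⟨m, n, by push_cast; ring⟩
  · exact Or.inr ⟨m, n, by push_cast; ring⟩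

theorem mem_segment_zero {w : ℂ} {s : ℝ} (h0 : 0 ≤ s) (h1 : s ≤ 1) :
    (s : ℂ) * w ∈ segment ℝ 0 w :=
  ⟨1 - s, s, by linarith, h0, by ring, by simp⟩

/-- The half-turn group identifies the points of the triangle `0, z₁, z₂` as its folding does. -/
theorem halfTurnSetoid_iff_foldRel {z : ℂ × ℂ} (h : areaNorm z ≠ 0) (x y : latticeTriangle z) :
    halfTurnSetoid (periods z) x y ↔ Relation.EqvGen (FoldRel z) x y := by
  have z1 : z.1 ∈ periods z := ⟨1, 0, by simp⟩
  have z2 : z.2 ∈ periods z := ⟨0, 1, by simp⟩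
  constructor
  · intro hxy
    have m0 : (0 : ℂ) ∈ latticeTriangle z := subset_convexHull _ _ (by simp)
    have m1 : z.1 ∈ latticeTriangle z := subset_convexHull _ _ (by simp)
    have m2 : z.2 ∈ latticeTriangle z := subset_convexHull _ _ (by simp)
    have r1 : Relation.EqvGen (FoldRel z) ⟨z.1, m1⟩ ⟨0, m0⟩ :=
      .rel _ _ (Or.inl ⟨right_mem_segment ℝ _ _, by simp⟩)
    have r2 : Relation.EqvGen (FoldRel z) ⟨z.2, m2⟩ ⟨0, m0⟩ :=
      .rel _ _ (Or.inr (Or.inr ⟨left_mem_segment ℝ _ _, by simp⟩))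
    -- Folding the two sides at `0` identifies all three vertices, which settles every exceptional
    -- case below.
    have corner : ∀ (x : latticeTriangle z) (s t : ℝ), IsCornerPoint s t →
        (x : ℂ) = s * z.1 + t * z.2 → Relation.EqvGen (FoldRel z) x ⟨0, m0⟩ := by
      rintro ⟨x, hx⟩ s t ⟨j, rfl, rfl⟩ rfl
      fin_cases j
      · convert Relation.EqvGen.refl (r := FoldRel z) ⟨0, m0⟩ using 2
        simp [cornerOffset]
      · convert r1 using 2
        simp [cornerOffset]
      · convert r2 using 2
        simp [cornerOffset]
    obtain ⟨x, hx⟩ := x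
    obtain ⟨y, hy⟩ := y
    obtain ⟨s, t, hst, rfl⟩ := mem_latticeTriangle.mp hx
    obtain ⟨s', t', hst', rfl⟩ := mem_latticeTriangle.mp hy
    have hcorner : IsCornerPoint s t ∧ IsCornerPoint s' t' →
        Relation.EqvGen (FoldRel z) ⟨s * z.1 + t * z.2, hx⟩ ⟨s' * z.1 + t' * z.2, hy⟩ :=
      fun hc => (corner _ _ _ hc.1 rfl).trans _ _ _ ((corner _ _ _ hc.2 rfl).symm _ _)
    rcases hxy with ⟨m, n, hmn⟩ | ⟨m, n, hmn⟩
    · obtain ⟨e1, e2⟩ := coord_unique h (s := s - s') (t := t - t') (s' := m) (t' := n)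
        (by push_cast; rw [← hmn]; ring)
      rcases hst.eq_or_corner hst' e1 e2 with ⟨rfl, rfl⟩ | hc
      · rw [Int.cast_zero, sub_eq_zero] at e1 e2
        subst e1 e2
        exact .refl _
      · exact hcorner hc
    · obtain ⟨e1, e2⟩ := coord_unique h (s := s + s') (t := t + t') (s' := m) (t' := n)
        (by push_cast; rw [← hmn]; ring)
      obtain ⟨a1, a2, a3⟩ := hst
      rcases InTriangle.side_or_corner ⟨a1, a2, a3⟩ hst' e1 e2 with
        ⟨rfl, rfl, rfl, rfl⟩ | ⟨rfl, rfl, h1, h2⟩ | ⟨rfl, rfl, rfl, rfl⟩ | hc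
      · refine .rel _ _ (Or.inl ⟨?_, ?_⟩)
        · simpa using mem_segment_zero (w := z.1) a1 (by linarith)
        · rw [Int.cast_one, Int.cast_zero] at hmn
          linear_combination hmn
      · refine .rel _ _ (Or.inr (Or.inl ⟨⟨s, t, a1, a2, h1, by simp⟩, ?_⟩))
        rw [Int.cast_one] at hmn
        linear_combination hmn
      · refine .rel _ _ (Or.inr (Or.inr ⟨?_, ?_⟩))
        · rw [segment_symm]
          simpa using mem_segment_zero (w := z.2) a2 (by linarith)
        · rw [Int.cast_one, Int.cast_zero] at hmn
          linear_combination hmn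
      · exact hcorner hc
  · intro hxy
    induction hxy with
    | rel x y hxy =>
      right
      rcases hxy with ⟨-, h⟩ | ⟨-, h⟩ | ⟨-, h⟩ <;> rw [h, add_sub_cancel]
      exacts [z1, add_mem z1 z2, z2]
    | refl x => exact Setoid.refl' _ _
    | symm x y _ ih => exact Setoid.symm' _ ih
    | trans x y w _ _ ih ih' => exact Setoid.trans' _ ih ih'

/-! ## Points of the glued surface -/

theorem rotateCoords_apply (r : Fin 3) (w : stdSimplex ℝ (Fin 3)) (i : Fin 3) :
    (rotateCoords r w).1 i = w.1 (i + r) := rfl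

theorem rotateCoords_rotateCoords (r s : Fin 3) (w : stdSimplex ℝ (Fin 3)) :
    rotateCoords r (rotateCoords s w) = rotateCoords (r + s) w := by
  ext i
  change (rotateCoords r (rotateCoords s w)).1 i = (rotateCoords (r + s) w).1 i
  rw [rotateCoords_apply, rotateCoords_apply, rotateCoords_apply, add_assoc]

theorem rotateCoords_zero (w : stdSimplex ℝ (Fin 3)) : rotateCoords 0 w = w := by
  ext i
  change (rotateCoords 0 w).1 i = w.1 i
  rw [rotateCoords_apply, add_zero]

theorem stdSimplex_sum (w : stdSimplex ℝ (Fin 3)) : w.1 0 + w.1 1 + w.1 2 = 1 := by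
  rw [← w.2.2, Fin.sum_univ_three]

theorem stdSimplex_inTriangle (w : stdSimplex ℝ (Fin 3)) : InTriangle (w.1 1) (w.1 2) :=
  ⟨w.2.1 1, w.2.1 2, by linarith [stdSimplex_sum w, w.2.1 0]⟩

theorem stdSimplex_ext {w w' : stdSimplex ℝ (Fin 3)} (h1 : w.1 1 = w'.1 1)
    (h2 : w.1 2 = w'.1 2) : w = w' := by
  have h := stdSimplex_sum w
  have h' := stdSimplex_sum w'
  apply Subtype.ext
  funext i
  fin_cases i
  · change w.1 0 = w'.1 0; linarith
  · exact h1
  · exact h2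

theorem exists_stdSimplex {s t : ℝ} (h : InTriangle s t) :
    ∃ w : stdSimplex ℝ (Fin 3), w.1 1 = s ∧ w.1 2 = t := by
  refine ⟨⟨![1 - s - t, s, t], ?_, ?_⟩, rfl, rfl⟩
  · intro i
    fin_cases i
    · change 0 ≤ 1 - s - t; linarith [h.2.2]
    · exact h.1
    · exact h.2.1
  · simp only [Fin.sum_univ_three, Matrix.cons_val]
    ring

/-- The barycentric coordinates of a vertex. -/
noncomputable def simplexVertex (i : Fin 3) : stdSimplex ℝ (Fin 3) :=
  ⟨Pi.single i 1, single_mem_stdSimplex ℝ i⟩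

theorem simplexVertex_one (j : Fin 3) : (simplexVertex j).1 1 = ((cornerOffset j).1 : ℝ) := by
  fin_cases j <;> simp [simplexVertex, cornerOffset]

theorem simplexVertex_two (j : Fin 3) : (simplexVertex j).1 2 = ((cornerOffset j).2 : ℝ) := by
  fin_cases j <;> simp [simplexVertex, cornerOffset]

namespace Triangulation

variable {X Y : Triangulation}

/-- The map of surfaces that is induced by an isomorphism. -/
noncomputable def Iso.mapRealization (e : Iso X Y) : X.Realization → Y.Realization :=
  Quot.lift (fun p => Y.point (e.toEquiv (p.1, 0)).1
    (rotateCoords (-(e.toEquiv (p.1, 0)).2) p.2)) (by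
  -- On each triangle the isomorphism shifts all indices by the same amount, so barycentric
  -- coordinates are rotated back by that amount.
  have hadd : ∀ (t : X.Face) (i : Fin 3),
      e.toEquiv (t, i) = ((e.toEquiv (t, 0)).1, (e.toEquiv (t, 0)).2 + i) := by
    intro t i
    have h1 := e.map_next t 0 _ _ rfl
    have h2 := e.map_next t (0 + 1) _ _ h1
    fin_cases i
    · change e.toEquiv (t, 0) = (_, _ + 0)
      rw [add_zero]
    · exact h1
    · change e.toEquiv (t, 2) = (_, _ + 2)
      refine h2.trans ?_
      rw [add_assoc]
      rfl
  have hcancel : ∀ j i l : Fin 3, j + i + l + -j = i + l := by decide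
  have hcancel' : ∀ j i : Fin 3, j + i + -j = i := by decide
  rintro ⟨t, w⟩ ⟨t', w'⟩ ⟨i, j, hg, h1, h2, h3, h4⟩
  refine Quot.sound ⟨(e.toEquiv (t, 0)).2 + i, (e.toEquiv (t', 0)).2 + j, ?_, ?_, ?_, ?_, ?_⟩
  · have := e.map_glue (t, i)
    rw [show X.glue (t, i) = (t', j) from hg, hadd, hadd t i] at this
    exact this.symm
  · rw [rotateCoords_apply, hcancel]; exact h1
  · rw [rotateCoords_apply, hcancel]; exact h2
  · rw [rotateCoords_apply, rotateCoords_apply, hcancel, hcancel']; exact h3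
  · rw [rotateCoords_apply, rotateCoords_apply, hcancel, hcancel']; exact h4)

theorem Iso.mapRealization_point (e : Iso X Y) (t : X.Face) (w : stdSimplex ℝ (Fin 3)) :
    e.mapRealization (X.point t w) = Y.point (e.toEquiv (t, 0)).1
      (rotateCoords (-(e.toEquiv (t, 0)).2) w) := rfl

theorem Iso.mapRealization_symm (e : Iso X Y) (p : X.Realization) :
    e.symm.mapRealization (e.mapRealization p) = p := by
  induction p using Quot.inductionOn with | h p => ?_
  obtain ⟨t, w⟩ := p
  change e.symm.mapRealization (e.mapRealization (X.point t w)) = X.point t w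
  rw [e.mapRealization_point, e.symm.mapRealization_point]
  obtain ⟨⟨t', j⟩, h⟩ : ∃ c, e.toEquiv (t, 0) = c := ⟨_, rfl⟩
  have hs : e.symm.toEquiv (t', j) = (t, 0) := by
    rw [← h]; exact e.toEquiv.symm_apply_apply _
  have hs0 : e.symm.toEquiv (t', 0) = (t, -j) := by
    have h1 := e.symm.map_next t' j _ _ hs
    have h2 := e.symm.map_next t' _ _ _ h1
    fin_cases j
    exacts [hs, h2, h1]
  rw [h, hs0]
  simp only [neg_neg]
  rw [rotateCoords_rotateCoords, add_neg_cancel, rotateCoords_zero]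

theorem Iso.isGluedFrom (e : Iso X Y) {z : ℂ × ℂ} (h : X.IsGluedFrom z) : Y.IsGluedFrom z := by
  obtain ⟨f, hf, hf', ht⟩ := h
  have hinv : ∀ p, e.mapRealization (e.symm.mapRealization p) = p := e.symm.mapRealization_symm
  refine ⟨e.mapRealization ∘ f, ?_, ?_, ?_⟩
  · intro p
    obtain ⟨x, hx⟩ := hf (e.symm.mapRealization p)
    exact ⟨x, by rw [Function.comp_apply, hx, hinv]⟩
  · intro x y
    rw [← hf', Function.comp_apply, Function.comp_apply,
      (Function.LeftInverse.injective e.mapRealization_symm).eq_iff]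
  · intro a ha k
    obtain ⟨t, r, htr⟩ := ht a ha k
    refine ⟨(e.toEquiv (t, 0)).1, -(e.toEquiv (t, 0)).2 + r, ?_⟩
    intro w x hx
    rw [Function.comp_apply, htr w x hx, e.mapRealization_point, rotateCoords_rotateCoords]

end Triangulation

/-! ## Tiles of the Eisenstein tiling -/

/-- The point with barycentric coordinates `w` in the triangle `b, b + 1, b + δ`. -/
noncomputable def tileMap (b : ℤ × ℤ) (w : stdSimplex ℝ (Fin 3)) : ℂ :=
  eisPoint b + w.1 1 + w.1 2 * delta

theorem tilePoint_zero (b : ℤ × ℤ) (w : stdSimplex ℝ (Fin 3)) :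
    tilePoint (eisPoint b) 0 w = tileMap b w := by
  have h : (w.1 0 : ℂ) + w.1 1 + w.1 2 = 1 := by exact_mod_cast stdSimplex_sum w
  rw [tilePoint, tileMap]
  linear_combination eisPoint b * h

/-- The half-turn about `0` sends a tile in direction `k + 1` to one in direction `k` with its
vertices cyclically shifted, by `δ² = δ - 1`. Iterating brings every tile to direction `0` up to
sign. -/
theorem tilePoint_succ (a : ℂ) (k : ℕ) (w : stdSimplex ℝ (Fin 3)) :
    tilePoint a (k + 1) w = -tilePoint (-a - delta ^ (k + 1)) k (rotateCoords 1 w) := by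
  have h : (w.1 0 : ℂ) + w.1 1 + w.1 2 = 1 := by exact_mod_cast stdSimplex_sum w
  have e0 : (rotateCoords 1 w).1 0 = w.1 1 := rfl
  have e1 : (rotateCoords 1 w).1 1 = w.1 2 := rfl
  have e2 : (rotateCoords 1 w).1 2 = w.1 0 := rfl
  rw [tilePoint, tilePoint, e0, e1, e2, pow_succ delta (k + 1), pow_succ delta k]
  linear_combination (w.1 2 : ℂ) * delta ^ k * delta_sq

theorem exists_tileMap {a : ℂ} (ha : a ∈ Eis) (k : ℕ) : ∃ (b : ℤ × ℤ) (r : Fin 3),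
    (∀ w, tilePoint a k w = tileMap b (rotateCoords r w)) ∨
      ∀ w, tilePoint a k w = -tileMap b (rotateCoords r w) := by
  induction k generalizing a with
  | zero =>
    obtain ⟨b, rfl⟩ := exists_eisPoint ha
    exact ⟨b, 0, Or.inl fun w => by rw [tilePoint_zero, rotateCoords_zero]⟩
  | succ k ih =>
    have hd : delta ∈ Eis := ⟨0, 1, by simp⟩
    obtain ⟨b, r, h | h⟩ := ih (sub_mem (neg_mem ha) (pow_mem hd (k + 1)))
    · exact ⟨b, r + 1, Or.inr fun w => by rw [tilePoint_succ, h, rotateCoords_rotateCoords]⟩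
    · exact ⟨b, r + 1, Or.inl fun w => by
        rw [tilePoint_succ, h, rotateCoords_rotateCoords, neg_neg]⟩

theorem areaNorm_one_delta : areaNorm (1, delta) ≠ 0 := by
  have := delta_im_pos
  simp only [areaNorm_eq, Complex.one_re, Complex.one_im]
  intro h
  linarith

theorem exists_tileMap_halfTurn (Λ : AddSubgroup ℂ) (x : ℂ) :
    ∃ (b : ℤ × ℤ) (w : stdSimplex ℝ (Fin 3)), halfTurnSetoid Λ x (tileMap b w) := by
  obtain ⟨s, t, rfl⟩ := exists_coord areaNorm_one_delta x
  obtain ⟨s', t', m, n, h', hc⟩ := exists_inTriangle s t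
  obtain ⟨w, rfl, rfl⟩ := exists_stdSimplex h'
  rcases hc with ⟨rfl, rfl⟩ | ⟨rfl, rfl⟩
  · refine ⟨(m, n), w, Or.inl ?_⟩
    convert zero_mem Λ
    rw [tileMap, eisPoint_apply]; push_cast; ring
  · refine ⟨(-m, -n), w, Or.inr ?_⟩
    convert zero_mem Λ
    rw [tileMap, eisPoint_apply]; push_cast; ring

/-! ### Points of the model surface and points of the plane -/

/-- The point of the surface with barycentric coordinates `w` in the triangle with base `a`. -/
noncomputable def latticePoint (z : ℂ × ℂ) (hfin : Finite ((ℤ × ℤ) ⧸ periodLattice z))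
    (heven : ∀ b ∈ periodLattice z, ∃ a, b = a + a) (a : (ℤ × ℤ) ⧸ periodLattice z)
    (w : stdSimplex ℝ (Fin 3)) : (latticeTriangulation (periodLattice z) hfin heven).Realization :=
  (latticeTriangulation (periodLattice z) hfin heven).point a w

section

variable {z : ℂ × ℂ} {hfin : Finite ((ℤ × ℤ) ⧸ periodLattice z)}
  {heven : ∀ b ∈ periodLattice z, ∃ a, b = a + a}

local notation "M" => latticeTriangulation (periodLattice z) hfin heven

theorem latticePoint_glue (a : (ℤ × ℤ) ⧸ periodLattice z) (i : Fin 3)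
    (w w' : stdSimplex ℝ (Fin 3)) (h1 : w.1 (i + 2) = 0) (h2 : w'.1 (i + 2) = 0)
    (h3 : w'.1 i = w.1 (i + 1)) (h4 : w'.1 (i + 1) = w.1 i) :
    latticePoint z hfin heven a w = latticePoint z hfin heven ((sideOffset i : ℤ × ℤ) - a) w' :=
  Quot.sound ⟨i, i, rfl, h1, h2, h3, h4⟩

theorem latticePoint_vertex_step (v : (ℤ × ℤ) ⧸ periodLattice z) (i : Fin 3) :
    latticePoint z hfin heven (v - (cornerOffset i : ℤ × ℤ)) (simplexVertex i) =
      latticePoint z hfin heven (-v - (cornerOffset (i + 1) : ℤ × ℤ)) (simplexVertex (i + 1)) := by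
  rw [latticePoint_glue _ i _ (simplexVertex (i + 1))]
  · congr 1
    rw [sideOffset, QuotientAddGroup.mk_neg, QuotientAddGroup.mk_add]
    abel
  all_goals fin_cases i <;> simp [simplexVertex]

/-- Let `f i` and `g i` be the point seen as vertex `i` of a triangle at `v` and at `-v`. Each
gluing gives `f i = g (i + 1)` and `g i = f (i + 1)`, and following these around the hexagon makes
all six equal. -/
theorem latticePoint_vertex (v : (ℤ × ℤ) ⧸ periodLattice z) (i j : Fin 3) :
    latticePoint z hfin heven (v - (cornerOffset i : ℤ × ℤ)) (simplexVertex i) =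
      latticePoint z hfin heven (v - (cornerOffset j : ℤ × ℤ)) (simplexVertex j) ∧
    latticePoint z hfin heven (v - (cornerOffset i : ℤ × ℤ)) (simplexVertex i) =
      latticePoint z hfin heven (-v - (cornerOffset j : ℤ × ℤ)) (simplexVertex j) := by
  have h1 := latticePoint_vertex_step (hfin := hfin) (heven := heven) v
  have h2 := latticePoint_vertex_step (hfin := hfin) (heven := heven) (-v)
  rw [neg_neg] at h2
  generalize hf : (fun (i : Fin 3) => latticePoint z hfin heven (v - (cornerOffset i : ℤ × ℤ))
    (simplexVertex i)) = f
  generalize hg : (fun (i : Fin 3) => latticePoint z hfin heven (-v - (cornerOffset i : ℤ × ℤ))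
    (simplexVertex i)) = g
  have h1' : ∀ i, f i = g (i + 1) := by rw [← hf, ← hg]; exact h1
  have h2' : ∀ i, g i = f (i + 1) := by rw [← hf, ← hg]; exact h2
  change (fun (i : Fin 3) => latticePoint z hfin heven (v - (cornerOffset i : ℤ × ℤ))
    (simplexVertex i)) i = (fun (i : Fin 3) => latticePoint z hfin heven
      (v - (cornerOffset i : ℤ × ℤ)) (simplexVertex i)) j ∧
    (fun (i : Fin 3) => latticePoint z hfin heven (v - (cornerOffset i : ℤ × ℤ))
    (simplexVertex i)) i = (fun (i : Fin 3) => latticePoint z hfin heven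
      (-v - (cornerOffset i : ℤ × ℤ)) (simplexVertex i)) j
  rw [hf, hg]
  have a0 := h1' 0
  have a1 := h1' 1
  have a2 := h1' 2
  have b1 := h2' 1
  have b2 := h2' 2
  simp only [Fin.isValue, Fin.reduceAdd] at a0 a1 a2 b1 b2
  have f1 : f 1 = f 0 := a1.trans b2
  have f2 : f 2 = f 0 := (a0.trans b1).symm
  have ff : ∀ i, f i = f 0 := by intro i; fin_cases i; exacts [rfl, f1, f2]
  have gg : ∀ i, g i = f 0 := by
    intro i
    fin_cases i
    exacts [a2.symm.trans f2, a0.symm, a1.symm.trans f1]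
  rw [ff i, ff j, gg j]
  exact ⟨rfl, rfl⟩

theorem latticePoint_vertex_eq {v v' : (ℤ × ℤ) ⧸ periodLattice z} (i j : Fin 3)
    (h : v + (cornerOffset i : ℤ × ℤ) = v' + (cornerOffset j : ℤ × ℤ) ∨
      v + (cornerOffset i : ℤ × ℤ) = -(v' + (cornerOffset j : ℤ × ℤ))) :
    latticePoint z hfin heven v (simplexVertex i) =
      latticePoint z hfin heven v' (simplexVertex j) := by
  have h1 := latticePoint_vertex (hfin := hfin) (heven := heven)
    (v + (cornerOffset i : ℤ × ℤ)) i j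
  rw [add_sub_cancel_right] at h1
  rcases h with h | h
  · rw [h1.1, h, add_sub_cancel_right]
  · rw [h1.2, h, neg_neg, add_sub_cancel_right]

theorem exists_periodLattice_of_mem_periods (hz : z ∈ latticeE) {x : ℂ} (hx : x ∈ periods z) :
    ∃ l ∈ periodLattice z, x = eisPoint l := by
  obtain ⟨p, q, rfl⟩ := exists_eisPoint_of_mem_latticeE hz
  obtain ⟨m, n, rfl⟩ := hx
  rw [← eisPoint_comb]
  exact ⟨_, mem_periodLattice_eisPoint.mpr ⟨m, n, rfl⟩, rfl⟩

/-- This makes the map from the plane to the surface well defined. Points related by a period lie in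
the same tile modulo the lattice, and points related by a half-turn lie on glued sides, unless they
are vertices. -/
theorem latticePoint_eq_of_halfTurn (hz : z ∈ latticeE) {b b' : ℤ × ℤ}
    {w w' : stdSimplex ℝ (Fin 3)}
    (h : halfTurnSetoid (periods z) (tileMap b w) (tileMap b' w')) :
    latticePoint z hfin heven b w = latticePoint z hfin heven b' w' := by
  have hw := stdSimplex_inTriangle w
  have hw' := stdSimplex_inTriangle w'
  have hs := stdSimplex_sum w
  have hs' := stdSimplex_sum w'
  have corner : ∀ w : stdSimplex ℝ (Fin 3), IsCornerPoint (w.1 1) (w.1 2) →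
      ∃ j, w = simplexVertex j ∧ ∀ b, tileMap b w = eisPoint (b + cornerOffset j) := by
    rintro w ⟨j, h1, h2⟩
    refine ⟨j, stdSimplex_ext (h1.trans (simplexVertex_one j).symm)
      (h2.trans (simplexVertex_two j).symm), fun b => ?_⟩
    rw [tileMap, h1, h2, map_add, eisPoint_apply (cornerOffset j)]
    push_cast
    ring
  have hcorner : IsCornerPoint (w.1 1) (w.1 2) ∧ IsCornerPoint (w'.1 1) (w'.1 2) →
      latticePoint z hfin heven b w = latticePoint z hfin heven b' w' := by
    rintro ⟨hc, hc'⟩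
    obtain ⟨j, rfl, hj⟩ := corner w hc
    obtain ⟨j', rfl, hj'⟩ := corner w' hc'
    refine latticePoint_vertex_eq j j' ?_
    rw [halfTurnSetoid_iff, hj, hj', ← map_sub, ← map_add] at h
    change b + cornerOffset j - (b' + cornerOffset j') ∈ periodLattice z ∨
      b + cornerOffset j + (b' + cornerOffset j') ∈ periodLattice z at h
    refine h.imp (fun h => ?_) (fun h => ?_)
    · rw [← sub_eq_zero]
      exact (QuotientAddGroup.eq_zero_iff _).mpr h
    · rw [eq_neg_iff_add_eq_zero]
      exact (QuotientAddGroup.eq_zero_iff _).mpr h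
  rcases h with h | h
  · obtain ⟨l, hl, hlw⟩ := exists_periodLattice_of_mem_periods hz h
    rw [tileMap, tileMap, eisPoint_apply, eisPoint_apply, eisPoint_apply] at hlw
    obtain ⟨e1, e2⟩ := coord_ext (s := w.1 1 - w'.1 1) (t := w.1 2 - w'.1 2)
      (s' := (l.1 - b.1 + b'.1 : ℤ)) (t' := (l.2 - b.2 + b'.2 : ℤ))
      (by push_cast; linear_combination hlw)
    rcases hw.eq_or_corner hw' e1 e2 with ⟨h1, h2⟩ | hc
    · rw [h1, Int.cast_zero, sub_eq_zero] at e1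
      rw [h2, Int.cast_zero, sub_eq_zero] at e2
      have hb : (b : (ℤ × ℤ) ⧸ periodLattice z) = b' := by
        rw [← sub_eq_zero, ← QuotientAddGroup.mk_sub, QuotientAddGroup.eq_zero_iff]
        convert hl using 1
        ext
        · simp; linarith
        · simp; linarith
      rw [hb, stdSimplex_ext e1 e2]
    · exact hcorner hc
  · obtain ⟨l, hl, hlw⟩ := exists_periodLattice_of_mem_periods hz h
    rw [tileMap, tileMap, eisPoint_apply, eisPoint_apply, eisPoint_apply] at hlw
    obtain ⟨e1, e2⟩ := coord_ext (s := w.1 1 + w'.1 1) (t := w.1 2 + w'.1 2)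
      (s' := (l.1 - b.1 - b'.1 : ℤ)) (t' := (l.2 - b.2 - b'.2 : ℤ))
      (by push_cast; linear_combination hlw)
    have hside : ∀ i : Fin 3, b + b' - sideOffset i = l →
        (b' : (ℤ × ℤ) ⧸ periodLattice z) = (sideOffset i : ℤ × ℤ) - b := by
      rintro i rfl
      rw [eq_comm, ← sub_eq_zero, ← neg_eq_zero, ← QuotientAddGroup.mk_sub,
        ← QuotientAddGroup.mk_sub, ← QuotientAddGroup.mk_neg, QuotientAddGroup.eq_zero_iff]
      convert hl using 1
      abel
    rcases hw.side_or_corner hw' e1 e2 with ⟨h1, h2, h3, h4⟩ | ⟨h1, h2, h3, h4⟩ |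
      ⟨h1, h2, h3, h4⟩ | hc
    · rw [hside 0 (by ext <;> simp [sideOffset, cornerOffset] <;> linarith)]
      rw [h1, Int.cast_one] at e1
      refine latticePoint_glue _ 0 w w' h3 h4 ?_ ?_
      · change w'.1 0 = w.1 1; linarith
      · change w'.1 1 = w.1 0; linarith
    · rw [hside 1 (by ext <;> simp [sideOffset, cornerOffset] <;> linarith)]
      rw [h1, Int.cast_one] at e1
      rw [h2, Int.cast_one] at e2
      refine latticePoint_glue _ 1 w w' ?_ ?_ ?_ ?_
      · change w.1 0 = 0; linarith
      · change w'.1 0 = 0; linarith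
      · change w'.1 1 = w.1 2; linarith
      · change w'.1 2 = w.1 1; linarith
    · rw [hside 2 (by ext <;> simp [sideOffset, cornerOffset] <;> linarith)]
      rw [h2, Int.cast_one] at e2
      refine latticePoint_glue _ 2 w w' h3 h4 ?_ ?_
      · change w'.1 2 = w.1 0; linarith
      · change w'.1 0 = w.1 2; linarith
    · exact hcorner hc

/-- The map from the surface to the quotient of the plane by translations and half-turns. -/
theorem exists_realization_to_plane : ∃ g : (M).Realization → Quotient (halfTurnSetoid (periods z)),
    ∀ (b : ℤ × ℤ) (w : stdSimplex ℝ (Fin 3)), g (latticePoint z hfin heven b w) =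
      Quotient.mk (halfTurnSetoid (periods z)) (tileMap b w) := by
  let g0 : ((ℤ × ℤ) ⧸ periodLattice z) → stdSimplex ℝ (Fin 3) →
      Quotient (halfTurnSetoid (periods z)) :=
    fun a w => Quotient.mk _ (tileMap (Quotient.out a) w)
  have hg0 : ∀ (b : ℤ × ℤ) (w : stdSimplex ℝ (Fin 3)), g0 b w = Quotient.mk _ (tileMap b w) := by
    intro b w
    refine Quotient.sound (Or.inl ?_)
    have h1 : ((Quotient.out (b : (ℤ × ℤ) ⧸ periodLattice z) : ℤ × ℤ) :
      (ℤ × ℤ) ⧸ periodLattice z) = b := Quotient.out_eq _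
    rw [← sub_eq_zero, ← QuotientAddGroup.mk_sub, QuotientAddGroup.eq_zero_iff] at h1
    change eisPoint _ ∈ periods z at h1
    convert h1 using 1
    rw [map_sub, tileMap, tileMap]
    ring
  refine ⟨Quot.lift (fun p => g0 p.1 p.2) ?_, fun b w => hg0 b w⟩
  rintro ⟨a, w⟩ ⟨a', w'⟩ ⟨i, j, hg, h1, h2, h3, h4⟩
  obtain ⟨b, rfl⟩ := QuotientAddGroup.mk_surjective (s := periodLattice z) a
  obtain ⟨rfl, rfl⟩ : ((sideOffset i : ℤ × ℤ) : (ℤ × ℤ) ⧸ periodLattice z) - b = a' ∧ i = j :=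
    Prod.ext_iff.mp hg
  change g0 b w = g0 (((sideOffset i : ℤ × ℤ) : (ℤ × ℤ) ⧸ periodLattice z) - b) w'
  rw [← QuotientAddGroup.mk_sub, hg0, hg0]
  -- With bases `b` and `sideOffset i - b`, glued points are exact negatives of each other, so the
  -- period needed is `0`.
  refine Quotient.sound (Or.inr ?_)
  convert zero_mem (periods z) using 1
  have hs : (w.1 0 : ℂ) + w.1 1 + w.1 2 = 1 := by exact_mod_cast stdSimplex_sum w
  have hs' : (w'.1 0 : ℂ) + w'.1 1 + w'.1 2 = 1 := by exact_mod_cast stdSimplex_sum w'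
  rw [tileMap, tileMap, map_sub]
  fin_cases i
  · change w.1 2 = 0 at h1
    change w'.1 2 = 0 at h2
    change w'.1 0 = w.1 1 at h3
    rw [h3, h2] at hs'
    rw [h1, h2, eisPoint_apply (sideOffset _)]
    simp [sideOffset, cornerOffset] at hs' ⊢
    linear_combination hs'
  · change w.1 0 = 0 at h1
    change w'.1 1 = w.1 2 at h3
    change w'.1 2 = w.1 1 at h4
    rw [h1] at hs
    rw [h3, h4, eisPoint_apply (sideOffset _)]
    simp [sideOffset, cornerOffset] at hs ⊢
    linear_combination (1 + delta) * hs
  · change w.1 1 = 0 at h1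
    change w'.1 1 = 0 at h2
    change w'.1 0 = w.1 2 at h4
    rw [h4, h2] at hs'
    rw [h1, h2, eisPoint_apply (sideOffset _)]
    simp [sideOffset, cornerOffset] at hs' ⊢
    linear_combination delta * hs'

/-- The map `F` sends a point of the plane to the surface through any tile containing it up to the
group; its fibres are exactly the orbits. Restricted to the triangle it stays onto, since the
triangle meets every orbit. -/
theorem latticeTriangulation_isGluedFrom (hz : z ∈ EPlus) : (M).IsGluedFrom z := by
  have harea : areaNorm z ≠ 0 := hz.2.ne'
  choose b w hbw using exists_tileMap_halfTurn (periods z)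
  obtain ⟨g, hg⟩ := exists_realization_to_plane (z := z) (hfin := hfin) (heven := heven)
  let F : ℂ → (M).Realization := fun x => latticePoint z hfin heven (b x) (w x)
  have hF : ∀ (x : ℂ) (c : ℤ × ℤ) (v : stdSimplex ℝ (Fin 3)),
      halfTurnSetoid (periods z) x (tileMap c v) → F x = latticePoint z hfin heven c v :=
    fun x c v h => latticePoint_eq_of_halfTurn hz.1 (Setoid.trans' _ (Setoid.symm' _ (hbw x)) h)
  have hF' : ∀ x y : ℂ, F x = F y ↔ halfTurnSetoid (periods z) x y := by
    intro x y
    constructor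
    · intro h
      have h1 := congrArg g h
      rw [hg, hg] at h1
      exact Setoid.trans' _ (hbw x) (Setoid.trans' _ (Quotient.exact h1) (Setoid.symm' _ (hbw y)))
    · intro h
      exact hF x _ _ (Setoid.trans' _ h (hbw y))
  refine ⟨fun x => F x, ?_, ?_, ?_⟩
  · intro p
    induction p using Quot.inductionOn with | h p => ?_
    obtain ⟨a, v⟩ := p
    obtain ⟨c, rfl⟩ := QuotientAddGroup.mk_surjective (s := periodLattice z) a
    obtain ⟨x, hx⟩ := exists_mem_latticeTriangle harea (tileMap c v)
    exact ⟨x, hF x c v (Setoid.symm' _ hx)⟩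
  · intro x y
    rw [hF', halfTurnSetoid_iff_foldRel harea]
  · intro a ha k
    obtain ⟨c, r, h⟩ := exists_tileMap ha k
    refine ⟨(c : (ℤ × ℤ) ⧸ periodLattice z), r, fun v x hx => hF x c (rotateCoords r v) ?_⟩
    rw [hx]
    rcases h with h | h
    · rw [h]
    · refine Or.inr ?_
      rw [h, neg_add_cancel]
      exact zero_mem _

end

/-! ## The bijection -/

/-- The triangulation of the quotient of the plane that belongs to `z`. -/
noncomputable def triangulationOf (z : EPlus) : TriangulationsOfType34 :=
  latticeType34 (periodLattice z.1) (areaNorm_eq_card z.2).1 (even_of_mem_periodLattice z.2.1)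

theorem triangulationOf_equiv_iff (z z' : EPlus) :
    triangulationOf z ≈ triangulationOf z' ↔ z ∈ MulAction.orbit DeltaSL z' := by
  rw [orbit_iff_periodLattice]
  exact latticeType34_equiv_iff

theorem exists_triangulationOf (X : TriangulationsOfType34) : ∃ z, triangulationOf z ≈ X := by
  obtain ⟨L, hfin, heven, hX⟩ := X.exists_lattice
  obtain ⟨z, hz, rfl⟩ := exists_periodLattice_eq L hfin heven
  exact ⟨⟨z, hz⟩, hX⟩

theorem mainTheorem1 :
    ∃ Φ : EPlusModDeltaSL ≃ HGEis34,
      ∀ (z : EPlus) (X : TriangulationsOfType34),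
        Φ (Quotient.mk _ z) = Quotient.mk _ X →
          X.1.IsGluedFrom z.1 ∧
          areaNorm z.1 = Real.sqrt 3 / 4 * (Nat.card X.1.Face : ℝ) := by
  let φ : EPlusModDeltaSL → HGEis34 := Quotient.map triangulationOf
    (fun z z' h => (triangulationOf_equiv_iff z z').mpr h)
  have hφ : Function.Bijective φ := by
    constructor
    · intro x y
      induction x using Quotient.inductionOn with | h z => ?_
      induction y using Quotient.inductionOn with | h z' => ?_
      intro h
      exact Quotient.sound ((triangulationOf_equiv_iff z z').mp (Quotient.exact h))
    · intro X
      induction X using Quotient.inductionOn with | h X => ?_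
      obtain ⟨z, hz⟩ := exists_triangulationOf X
      exact ⟨Quotient.mk _ z, Quotient.sound hz⟩
  refine ⟨Equiv.ofBijective φ hφ, fun z X h => ?_⟩
  obtain ⟨e⟩ : triangulationOf z ≈ X := Quotient.exact h
  refine ⟨e.isGluedFrom (latticeTriangulation_isGluedFrom
    (heven := even_of_mem_periodLattice z.2.1) z.2), ?_⟩
  -- An isomorphism is a bijection of corners, three to each face.
  have hcard : Nat.card ((ℤ × ℤ) ⧸ periodLattice z.1) = Nat.card X.1.Face := by
    have := Nat.card_congr e.toEquiv
    rw [Nat.card_prod, Nat.card_prod, Nat.card_fin] at this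
    exact Nat.eq_of_mul_eq_mul_right (by norm_num) this
  rw [← hcard]
  exact (areaNorm_eq_card z.2).2
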